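/- Let $m>0$. For $a\in\mathbb R$ with $a^2<m^2$ consider the slow Kerr metric, in Boyer–Lindquist coordinates $(r,\theta,\varphi,t)$, $$g^a=-\frac{\Delta}{\rho^2}\left(dt-a\sin^2\theta\,d\varphi\right)^2+\frac{\sin^2\theta}{\rho^2}\left((r^2+a^2)\,d\varphi-a\,dt\right)^2+\frac{\rho^2}{\Delta}\,dr^2+\rho^2\,d\theta^2,$$ where $\Delta=r^2-2mr+a^2$ and $\rho^2=r^2+a^2\cos^2\theta$. Here $(r,\theta,\varphi)$ are regarded as spherical coordinates of $\mathbb R^3\ni(x,y,z)$, and $g^a$ is extended smoothly across the axis $x=y=0$, so that it is a Lorentzian metric on $M^a=S^a\times\mathbb R$, with $S^a=\{m+\sqrt{m^2-a^2\cos^2\theta}<r\}\subset\mathbb R^3$ the region outside the ergosurface. For $\varepsilon>0$ and $r_0\in(0,\infty]$ put $$D^a_{\varepsilon,r_0}=\left\{(x,y,z)\in\mathbb R^3:\ m+\sqrt{m^2+\varepsilon-a^2\cos^2\theta}<r<r_0\right\}.$$ Given a domain (open, connected, non-empty set) $D$ with closure contained in $S^a$, the stationary domain $D\times\mathbb R$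 has *strongly light-convex boundary* if there is a smooth function $\phi:S^a\to\mathbb R$ with $\phi^{-1}(0)=\partial D$, $\phi>0$ on $D$ and $d\phi\neq0$ on $\partial D$, such that $\Phi(x,t)=\phi(x)$ satisfies $H_\Phi(v,v)<0$ for every lightlike vector $v$ (that is, $v\ne0$ and $g^a(v,v)=0$) tangent to $\partial D\times\mathbb R$, where $H_\Phi=\nabla(d\Phi)$ is the Hessian of $\Phi$ with respect to the Levi-Civita connection of $g^a$. Then there is $R>0$, depending only on $m$, such that for every $\varepsilon\in(0,3m^2)$ there is $a_0>0$, depending only on $m$ and $\varepsilon$, such that for all $a$ with $a^2<m^2$ and $|a|<a_0$, and all $r_0\in(R,\infty]$, the set $D^a_{\varepsilon,r_0}$ is a domain with closure contained in $S^a$, and the stationary domain $D^a_{\varepsilon,r_0}\times\mathbb R$ of $(M^a,g^a)$ has strongly light-convex boundary. -/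

import Mathlib

open scoped ContDiff Matrix

noncomputable section

namespace KerrShell

/-! ### Levi-Civita Hessian of a semi-Riemannian metric in a coordinate chart of `ℝⁿ` -/

section Hessian

variable {n : ℕ}

/-- The partial derivative `∂_i f` of a function on `ℝⁿ`. -/
def pderiv (i : Fin n) (f : (Fin n → ℝ) → ℝ) (p : Fin n → ℝ) : ℝ :=
  fderiv ℝ f p (Pi.single i 1)

/-- The Christoffel symbol `Γ^k_{ij}` of the Levi-Civita connection of the metric with component
matrix `g`: `Γ^k_{ij} = ½ ∑_l g^{kl} (∂_i g_{jl} + ∂_j g_{il} - ∂_l g_{ij})`. -/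
def christoffel (g : (Fin n → ℝ) → Matrix (Fin n) (Fin n) ℝ) (k i j : Fin n)
    (p : Fin n → ℝ) : ℝ :=
  (1 / 2) * ∑ l, (g p)⁻¹ k l *
    (pderiv i (fun q => g q j l) p + pderiv j (fun q => g q i l) p - pderiv l (fun q => g q i j) p)

/-- The Hessian `H^g_Φ = ∇(dΦ)` of `Φ` with respect to the Levi-Civita connection of `g`,
at the point `p`, evaluated on the tangent vectors `v`, `w`:
`∑_{ij} (∂_i ∂_j Φ - ∑_k Γ^k_{ij} ∂_k Φ) v^i w^j`. -/
def hessian (g : (Fin n → ℝ) → Matrix (Fin n) (Fin n) ℝ) (Φ : (Fin n → ℝ) → ℝ)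
    (p v w : Fin n → ℝ) : ℝ :=
  ∑ i, ∑ j, (pderiv i (pderiv j Φ) p - ∑ k, christoffel g k i j p * pderiv k Φ p) * v i * w j

/-- A vector `v` at `p` is lightlike for the metric `g`: it is nonzero and `g_p(v, v) = 0`. -/
def IsLightlike (g : (Fin n → ℝ) → Matrix (Fin n) (Fin n) ℝ) (p v : Fin n → ℝ) : Prop :=
  v ≠ 0 ∧ v ⬝ᵥ (g p *ᵥ v) = 0

end Hessian

/-! ### Stationary domains and light-convexity

Points of `ℝ³ × ℝ` are written `p : Fin 4 → ℝ`; the coordinates are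
`p 0 = x`, `p 1 = y`, `p 2 = z` and the time `p 3 = t`. -/

/-- The projection `(x, y, z, t) ↦ (x, y, z)`. -/
def space (p : Fin 4 → ℝ) : Fin 3 → ℝ := fun i => p i.castSucc

/-- `D` is a domain (open and connected) of the open set `S ⊆ ℝ³`, its closure is contained in `S`,
and `φ : S → ℝ` is a smooth function with `φ⁻¹(0) = ∂D`, `φ > 0` on `D`, and
`dφ ≠ 0` along `∂D`. In particular, `∂D` is smooth. -/
structure IsDefiningFunction (S D : Set (Fin 3 → ℝ)) (φ : (Fin 3 → ℝ) → ℝ) : Prop where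
  isOpen : IsOpen D
  isConnected : IsConnected D
  closure_subset : closure D ⊆ S
  contDiffOn : ContDiffOn ℝ ∞ φ S
  zero_iff : ∀ x ∈ S, φ x = 0 ↔ x ∈ frontier D
  pos : ∀ x ∈ D, 0 < φ x
  fderiv_ne_zero : ∀ x ∈ frontier D, fderiv ℝ φ x ≠ 0

/-- The stationary domain `D × ℝ` of the spacetime `(S × ℝ, g)` has strongly light-convex
boundary: for a function `Φ(x, t) = φ(x)` defining `∂D × ℝ`, the Hessian of `Φ` with respect to `g`
is negative on every lightlike vector tangent to `∂D × ℝ`, the tangent space at `p` being the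
kernel of `dΦ_p`. -/
def HasStronglyLightConvexBoundary (S : Set (Fin 3 → ℝ))
    (g : (Fin 4 → ℝ) → Matrix (Fin 4) (Fin 4) ℝ) (D : Set (Fin 3 → ℝ)) : Prop :=
  ∃ φ : (Fin 3 → ℝ) → ℝ, IsDefiningFunction S D φ ∧
    ∀ p : Fin 4 → ℝ, space p ∈ frontier D →
      ∀ v : Fin 4 → ℝ, fderiv ℝ φ (space p) (space v) = 0 → IsLightlike g p v →
        hessian g (fun q => φ (space q)) p v v < 0

/-! ### Kerr spacetime

The Boyer-Lindquist coordinates `r`, `θ`, `φ` are regarded as the spherical coordinates of `ℝ³`,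
`(x, y, z) = (r sin θ cos φ, r sin θ sin φ, r cos θ)`. -/

/-- The radial coordinate `r`. -/
def radius (x : Fin 3 → ℝ) : ℝ := √(x 0 ^ 2 + x 1 ^ 2 + x 2 ^ 2)

/-- `cos θ = z / r`. -/
def cosTheta (x : Fin 3 → ℝ) : ℝ := x 2 / radius x

/-- `Δ = r² - 2 m r + a²`. -/
def kerrDelta (m a : ℝ) (x : Fin 3 → ℝ) : ℝ := radius x ^ 2 - 2 * m * radius x + a ^ 2

/-- `ρ² = r² + a² cos² θ`. -/
def kerrRhoSq (a : ℝ) (x : Fin 3 → ℝ) : ℝ := radius x ^ 2 + a ^ 2 * cosTheta x ^ 2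

/-- The components of the Euclidean metric `dx² + dy² + dz²` of `ℝ³`, as a form on `ℝ⁴`. -/
def euclid : Matrix (Fin 4) (Fin 4) ℝ := Matrix.diagonal ![1, 1, 1, 0]

/-- The components of the one-form `dr = (x dx + y dy + z dz) / r`. -/
def formDr (x : Fin 3 → ℝ) : Fin 4 → ℝ :=
  ![x 0 / radius x, x 1 / radius x, x 2 / radius x, 0]

/-- The components of the one-form `sin² θ dφ = (x dy - y dx) / r²`. -/
def formSinSqDphi (x : Fin 3 → ℝ) : Fin 4 → ℝ :=
  ![-(x 1) / radius x ^ 2, x 0 / radius x ^ 2, 0, 0]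

/-- The components of the one-form `dt`. -/
def formDt : Fin 4 → ℝ := ![0, 0, 0, 1]

/-- The component matrix of the Kerr metric in the coordinates `(x, y, z, t)`. Writing
`α = sin² θ dφ` and `dΩ² = dθ² + sin² θ dφ² = (dx² + dy² + dz² - dr²) / r²`, the Kerr metric is
`ρ² / Δ dr² + ρ² dΩ² + a² (1 + 2 m r / ρ²) α² - (4 m r a / ρ²) α dt - (1 - 2 m r / ρ²) dt²`;
this expression is also valid, and smooth, at the axis `x = y = 0`. It is shown in
`kerrMetric_boyerLindquist` to be the usual expression in Boyer-Lindquist coordinates. -/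
def kerrMetric (m a : ℝ) (p : Fin 4 → ℝ) : Matrix (Fin 4) (Fin 4) ℝ :=
  let x := space p
  let r := radius x
  let ρ2 := kerrRhoSq a x
  let dr := formDr x
  let α := formSinSqDphi x
  let dt := formDt
  (ρ2 / kerrDelta m a x) • Matrix.vecMulVec dr dr
    + (ρ2 / r ^ 2) • (euclid - Matrix.vecMulVec dr dr)
    + (a ^ 2 * (1 + 2 * m * r / ρ2)) • Matrix.vecMulVec α α
    - (2 * m * r * a / ρ2) • (Matrix.vecMulVec α dt + Matrix.vecMulVec dt α)
    - (1 - 2 * m * r / ρ2) • Matrix.vecMulVec dt dt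

/-- The region of `ℝ³` outside the ergosurface `r = m + √(m² - a² cos² θ)`; the stationary region
of the Kerr spacetime is `kerrRegion m a × ℝ`. -/
def kerrRegion (m a : ℝ) : Set (Fin 3 → ℝ) :=
  {x | m + √(m ^ 2 - a ^ 2 * cosTheta x ^ 2) < radius x}

/-- The shell `{m + √(m² + ε - a² cos² θ) < r < r₀}`, where `r₀ = ∞` is allowed. -/
def kerrShell (m a ε : ℝ) (r₀ : EReal) : Set (Fin 3 → ℝ) :=
  {x | m + √(m ^ 2 + ε - a ^ 2 * cosTheta x ^ 2) < radius x ∧ (radius x : EReal) < r₀}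

/-- The point of `ℝ³ × ℝ` with Boyer-Lindquist coordinates `(r, θ, φ, t)`. -/
def blPoint (r θ φ t : ℝ) : Fin 4 → ℝ :=
  ![r * Real.sin θ * Real.cos φ, r * Real.sin θ * Real.sin φ, r * Real.cos θ, t]

/-- The vector `ṙ ∂_r + θ̇ ∂_θ + φ̇ ∂_φ + ṫ ∂_t` at the point with Boyer-Lindquist coordinates
`(r, θ, φ, t)`. -/
def blVector (r θ φ rdot θdot φdot tdot : ℝ) : Fin 4 → ℝ :=
  ![rdot * (Real.sin θ * Real.cos φ) + θdot * (r * Real.cos θ * Real.cos φ)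
      + φdot * (-(r * Real.sin θ * Real.sin φ)),
    rdot * (Real.sin θ * Real.sin φ) + θdot * (r * Real.cos θ * Real.sin φ)
      + φdot * (r * Real.sin θ * Real.cos φ),
    rdot * Real.cos θ + θdot * (-(r * Real.sin θ)),
    tdot]

/-- The quadratic form of the Kerr metric in terms of the one-forms used to define it. -/
theorem kerrMetric_quadratic (m a : ℝ) (p v : Fin 4 → ℝ) :
    v ⬝ᵥ (kerrMetric m a p *ᵥ v) =
      kerrRhoSq a (space p) / kerrDelta m a (space p) * (formDr (space p) ⬝ᵥ v) ^ 2
        + kerrRhoSq a (space p) / radius (space p) ^ 2 *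
          (v 0 ^ 2 + v 1 ^ 2 + v 2 ^ 2 - (formDr (space p) ⬝ᵥ v) ^ 2)
        + a ^ 2 * (1 + 2 * m * radius (space p) / kerrRhoSq a (space p)) *
          (formSinSqDphi (space p) ⬝ᵥ v) ^ 2
        - 4 * m * radius (space p) * a / kerrRhoSq a (space p) *
          ((formSinSqDphi (space p) ⬝ᵥ v) * v 3)
        - (1 - 2 * m * radius (space p) / kerrRhoSq a (space p)) * v 3 ^ 2 := by
  have hE : v ⬝ᵥ (euclid *ᵥ v) = v 0 ^ 2 + v 1 ^ 2 + v 2 ^ 2 := by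
    simp [euclid, Matrix.mulVec_diagonal, dotProduct, Fin.sum_univ_four]
    ring
  have hT : formDt ⬝ᵥ v = v 3 := by
    simp [formDt, dotProduct, Fin.sum_univ_four]
  have hV : ∀ u w : Fin 4 → ℝ,
      v ⬝ᵥ (Matrix.vecMulVec u w *ᵥ v) = (u ⬝ᵥ v) * (w ⬝ᵥ v) := by
    intro u w
    simp [Matrix.mulVec, Matrix.vecMulVec, dotProduct, Fin.sum_univ_four]
    ring
  simp only [kerrMetric, Matrix.add_mulVec, Matrix.sub_mulVec, Matrix.smul_mulVec,
    dotProduct_add, dotProduct_sub, dotProduct_smul, hE, hV, hT, smul_eq_mul]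
  ring

/-- In Boyer-Lindquist coordinates, the metric above is the Kerr metric
`-(Δ / ρ²) (dt - a sin² θ dφ)² + (sin² θ / ρ²) ((r² + a²) dφ - a dt)² + (ρ² / Δ) dr² + ρ² dθ²`. -/
theorem kerrMetric_boyerLindquist (m a r θ φ t rdot θdot φdot tdot : ℝ) (hr : 0 < r) :
    let Δ := r ^ 2 - 2 * m * r + a ^ 2
    let ρ2 := r ^ 2 + a ^ 2 * Real.cos θ ^ 2
    let v := blVector r θ φ rdot θdot φdot tdot
    v ⬝ᵥ (kerrMetric m a (blPoint r θ φ t) *ᵥ v) =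
      -(Δ / ρ2) * (tdot - a * Real.sin θ ^ 2 * φdot) ^ 2
        + Real.sin θ ^ 2 / ρ2 * ((r ^ 2 + a ^ 2) * φdot - a * tdot) ^ 2
        + ρ2 / Δ * rdot ^ 2 + ρ2 * θdot ^ 2 := by
  have hs : Real.sin θ ^ 2 + Real.cos θ ^ 2 = 1 := Real.sin_sq_add_cos_sq θ
  have hc : Real.sin φ ^ 2 + Real.cos φ ^ 2 = 1 := Real.sin_sq_add_cos_sq φ
  have h0 : space (blPoint r θ φ t) 0 = r * Real.sin θ * Real.cos φ := rfl
  have h1 : space (blPoint r θ φ t) 1 = r * Real.sin θ * Real.sin φ := rfl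
  have h2 : space (blPoint r θ φ t) 2 = r * Real.cos θ := rfl
  have hrad : radius (space (blPoint r θ φ t)) = r := by
    rw [radius, h0, h1, h2, Real.sqrt_eq_iff_mul_self_eq (by positivity) hr.le]
    linear_combination r ^ 2 * Real.sin θ ^ 2 * hc + r ^ 2 * hs
  have hcos : cosTheta (space (blPoint r θ φ t)) = Real.cos θ := by
    rw [cosTheta, hrad, h2]
    field_simp
  have hdr : formDr (space (blPoint r θ φ t)) ⬝ᵥ blVector r θ φ rdot θdot φdot tdot = rdot := by
    simp [formDr, hrad, h0, h1, h2, blVector, dotProduct, Fin.sum_univ_four]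
    field_simp
    linear_combination
      (rdot * Real.sin θ ^ 2 + r * θdot * Real.sin θ * Real.cos θ) * hc + rdot * hs
  have hα : formSinSqDphi (space (blPoint r θ φ t)) ⬝ᵥ blVector r θ φ rdot θdot φdot tdot
      = Real.sin θ ^ 2 * φdot := by
    simp [formSinSqDphi, hrad, h0, h1, blVector, dotProduct, Fin.sum_univ_four]
    field_simp
    linear_combination (r * Real.sin θ ^ 2 * φdot) * hc
  have hv3 : blVector r θ φ rdot θdot φdot tdot 3 = tdot := rfl
  have hv : blVector r θ φ rdot θdot φdot tdot 0 ^ 2 + blVector r θ φ rdot θdot φdot tdot 1 ^ 2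
      + blVector r θ φ rdot θdot φdot tdot 2 ^ 2
      = rdot ^ 2 + r ^ 2 * θdot ^ 2 + r ^ 2 * Real.sin θ ^ 2 * φdot ^ 2 := by
    simp [blVector]
    linear_combination ((rdot * Real.sin θ + θdot * r * Real.cos θ) ^ 2
      + φdot ^ 2 * r ^ 2 * Real.sin θ ^ 2) * hc + (rdot ^ 2 + r ^ 2 * θdot ^ 2) * hs
  have hρ : r ^ 2 + a ^ 2 * Real.cos θ ^ 2 ≠ 0 := by positivity
  intro Δ ρ2 v
  simp only [v, Δ, ρ2]
  rw [kerrMetric_quadratic, hdr, hα, hv, hv3]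
  simp only [kerrRhoSq, kerrDelta, hrad, hcos]
  have hcs : Real.cos θ ^ 2 = 1 - Real.sin θ ^ 2 := by linarith
  rw [hcs] at hρ ⊢
  field_simp
  ring

end KerrShell

end

noncomputable section

namespace KerrShell

open Topology Filter

/-! ### Hessians, Lie derivatives and products of functions, for a metric on a chart of `ℝⁿ` -/

section General

variable {n : ℕ}

/-! The boundary of the shell has an inner piece `ψ = 0`, where `ψ = r² - 2mr + a² cos² θ - ε`, and
for finite `r₀` an outer piece `r = r₀`. With `η = r² - r₀²`, the defining function is `-ηψ`, or `ψ`
alone when `r₀ = ∞`. On vectors tangent to the zero set of one factor, the Hessian of a product is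
the other factor times the Hessian of the first (`hessian_mul_of_eq_zero`). It thus suffices that,
on lightlike tangent vectors, the Hessian of `ψ` is negative on `ψ = 0` and that of `r²` is positive
on `r = r₀`.

Both functions have the form `r² - 2μr + b cos² θ - k`. No Christoffel symbol of Kerr is computed:
if `X = c grad Φ`, then `2c Hess Φ (v, v) = (L_X g)(v, v)` whenever `dΦ(v) = 0`
(`mul_hessian_eq_lieDeriv`). For `c = ρ²/2` the field is `X = Δ(r - μ) ∂_r + b cos θ sin² θ ∂_{cos
θ}`, and `L_X g` is an explicit quadratic expression, `lieForm`, in the values of `dr`, `sin² θ dφ`,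
`dt` and the round metric on `v`. This is `kerrRhoSq_mul_hessian`.

The outer sign is an estimate valid for `r > 10m` (`lieForm_pos_of_large`). For the inner sign, let
first `a = 0`: on null tangent vectors `lieForm` is a positive multiple of `(r - 3m) dt²`, so
negativity means lying inside the photon sphere `r = 3m`. Since `r² - 2mr = 3m²` there, this is the
condition `ε < 3m²`. Normalised tangent directions form a compact set, so the strict sign persists
for all small `|a|`, uniformly over the inner boundary (`exists_forall_lieForm_neg`). The resulting
`a₀` does not involve `r₀`.

The topology of the shell comes from scaling: `cos θ` is constant on rays, so membership in the
shell is a condition on `r` along each ray, and all rays meet the sphere `r = 3m` inside the shell.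
-/

theorem fderiv_apply_eq_sum_pderiv (f : (Fin n → ℝ) → ℝ) (p w : Fin n → ℝ) :
    fderiv ℝ f p w = ∑ k, w k * pderiv k f p := by
  conv_lhs => rw [← Finset.univ_sum_single w, map_sum]
  refine Finset.sum_congr rfl fun k _ => ?_
  have : (Pi.single k (w k) : Fin n → ℝ) = w k • Pi.single k 1 := by
    ext j; by_cases h : j = k
    · subst h; simp
    · simp [h]
  rw [this, map_smul, smul_eq_mul, pderiv]

theorem hasDerivAt_comp_line {f : (Fin n → ℝ) → ℝ} {p : Fin n → ℝ} (hf : DifferentiableAt ℝ f p)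
    (w : Fin n → ℝ) : HasDerivAt (fun h : ℝ => f (p + h • w)) (∑ k, w k * pderiv k f p) 0 := by
  rw [← fderiv_apply_eq_sum_pderiv]
  have h1 : HasDerivAt (fun h : ℝ => p + h • w) w 0 := by
    simpa using ((hasDerivAt_id (0 : ℝ)).smul_const w).const_add p
  have h2 : HasFDerivAt f (fderiv ℝ f p) (p + (0 : ℝ) • w) := by simpa using hf.hasFDerivAt
  exact h2.comp_hasDerivAt (0 : ℝ) h1

theorem tendsto_line (p w : Fin n → ℝ) : Tendsto (fun h : ℝ => p + h • w) (𝓝 0) (𝓝 p) := by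
  have : Continuous fun h : ℝ => p + h • w := by fun_prop
  simpa using this.tendsto 0

/-- If `X` is a multiple `c • grad Φ` of the gradient of `Φ`, then on vectors `v` in the kernel of
`dΦ` the Hessian of `Φ` is, up to the factor `2 c`, the Lie derivative of the metric along `X`. -/
theorem mul_hessian_eq_lieDeriv {g : (Fin n → ℝ) → Matrix (Fin n) (Fin n) ℝ}
    {Φ c : (Fin n → ℝ) → ℝ} {X : (Fin n → ℝ) → (Fin n → ℝ)} {p v Y : Fin n → ℝ} {Q : ℝ}
    (hsymm : ∀ i j, g p i j = g p j i) (hdet : (g p).det ≠ 0)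
    (hg : ∀ i j, DifferentiableAt ℝ (fun q => g q i j) p)
    (hΦ : ∀ j, DifferentiableAt ℝ (pderiv j Φ) p) (hc : DifferentiableAt ℝ c p)
    (hX : HasDerivAt (fun h : ℝ => X (p + h • v)) Y 0)
    (hgrad : ∀ᶠ q in 𝓝 p, ∀ j, (g q *ᵥ X q) j = c q * pderiv j Φ q)
    (hv : ∑ j, v j * pderiv j Φ p = 0)
    (hQ : HasDerivAt (fun h : ℝ => (v + h • Y) ⬝ᵥ (g (p + h • X p) *ᵥ (v + h • Y))) Q 0) :
    2 * (c p * hessian g Φ p v v) = Q := by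
  set dg : Fin n → Fin n → Fin n → ℝ := fun k i j => pderiv k (fun q => g q i j) p with hdg
  set H : Fin n → Fin n → ℝ := fun i j => pderiv i (pderiv j Φ) p with hH
  have hgp : ∀ j, ∑ l, g p j l * X p l = c p * pderiv j Φ p := fun j => by
    simpa [Matrix.mulVec, dotProduct] using hgrad.self_of_nhds j
  -- the gradient
  have hW : ∀ l, c p * ∑ k, (g p)⁻¹ k l * pderiv k Φ p = X p l := by
    intro l
    have hT : ((g p)⁻¹)ᵀ = (g p)⁻¹ := by
      rw [Matrix.transpose_nonsing_inv]
      congr 1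
      ext i j
      exact hsymm j i
    have h1 : (g p)⁻¹ *ᵥ (g p *ᵥ X p) = X p := by
      rw [Matrix.mulVec_mulVec, Matrix.nonsing_inv_mul _ (isUnit_iff_ne_zero.mpr hdet),
        Matrix.one_mulVec]
    have h2 : g p *ᵥ X p = fun j => c p * pderiv j Φ p := by
      ext j; exact hgrad.self_of_nhds j
    rw [h2] at h1
    have h3 := congrFun h1 l
    rw [← h3, Matrix.mulVec, dotProduct, Finset.mul_sum]
    refine Finset.sum_congr rfl fun k _ => ?_
    have : (g p)⁻¹ k l = (g p)⁻¹ l k := by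
      conv_lhs => rw [← hT, Matrix.transpose_apply]
    rw [this]; ring
  -- differentiate the gradient relation along `v`
  have hrel : ∀ j, ∑ l, ((∑ i, v i * dg i j l) * X p l + g p j l * Y l)
      = (∑ i, v i * pderiv i c p) * pderiv j Φ p + c p * ∑ i, v i * H i j := by
    intro j
    have hl : HasDerivAt (fun h : ℝ => ∑ l, g (p + h • v) j l * X (p + h • v) l)
        (∑ l, ((∑ i, v i * dg i j l) * X p l + g p j l * Y l)) 0 := by
      refine HasDerivAt.fun_sum fun l _ => ?_
      simpa using (hasDerivAt_comp_line (hg j l) v).fun_mul (hasDerivAt_pi.1 hX l)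
    have hr : HasDerivAt (fun h : ℝ => c (p + h • v) * pderiv j Φ (p + h • v))
        ((∑ i, v i * pderiv i c p) * pderiv j Φ p + c p * ∑ i, v i * H i j) 0 := by
      simpa using (hasDerivAt_comp_line hc v).fun_mul (hasDerivAt_comp_line (hΦ j) v)
    refine hl.unique (hr.congr_of_eventuallyEq ?_)
    filter_upwards [(tendsto_line p v).eventually hgrad] with h hh
    simpa [Matrix.mulVec, dotProduct] using hh j
  -- the derivative of the quadratic form
  have hQ' : HasDerivAt (fun h : ℝ => (v + h • Y) ⬝ᵥ (g (p + h • X p) *ᵥ (v + h • Y)))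
      (∑ i, (Y i * ∑ j, g p i j * v j
        + v i * ∑ j, ((∑ k, X p k * dg k i j) * v j + g p i j * Y j))) 0 := by
    have hw : ∀ i, HasDerivAt (fun h : ℝ => v i + h * Y i) (Y i) 0 := fun i => by
      simpa using ((hasDerivAt_id (0 : ℝ)).mul_const (Y i)).const_add (v i)
    have : ∀ i, HasDerivAt (fun h : ℝ => (v i + h * Y i) *
        ∑ j, g (p + h • X p) i j * (v j + h * Y j))
        (Y i * ∑ j, g p i j * v j
          + v i * ∑ j, ((∑ k, X p k * dg k i j) * v j + g p i j * Y j)) 0 := by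
      intro i
      have hs : HasDerivAt (fun h : ℝ => ∑ j, g (p + h • X p) i j * (v j + h * Y j))
          (∑ j, ((∑ k, X p k * dg k i j) * v j + g p i j * Y j)) 0 := by
        refine HasDerivAt.fun_sum fun j _ => ?_
        simpa using (hasDerivAt_comp_line (hg i j) (X p)).fun_mul (hw j)
      simpa using (hw i).fun_mul hs
    simpa [Matrix.mulVec, dotProduct] using HasDerivAt.fun_sum fun i (_ : i ∈ Finset.univ) => this i
  rw [hQ.unique hQ']
  -- abbreviations for the contractions
  have e1 : ∑ j, v j * ∑ l, ((∑ i, v i * dg i j l) * X p l + g p j l * Y l)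
      = c p * ∑ j, ∑ i, H i j * v i * v j := by
    simp_rw [hrel, mul_add, Finset.sum_add_distrib]
    -- The derivative of `c` enters only multiplied by `dΦ(v) = 0`, which is why a non-constant
    -- factor `c` is allowed.
    have : ∑ j, v j * ((∑ i, v i * pderiv i c p) * pderiv j Φ p) = 0 := by
      calc _ = (∑ i, v i * pderiv i c p) * ∑ j, v j * pderiv j Φ p := by
            rw [Finset.mul_sum]; exact Finset.sum_congr rfl fun j _ => by ring
        _ = 0 := by rw [hv, mul_zero]
    rw [this, zero_add, Finset.mul_sum]
    refine Finset.sum_congr rfl fun j _ => ?_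
    rw [Finset.mul_sum, Finset.mul_sum, Finset.mul_sum]
    exact Finset.sum_congr rfl fun i _ => by ring
  have e2 : c p * ∑ i, ∑ j, (∑ k, christoffel g k i j p * pderiv k Φ p) * v i * v j
      = ∑ i, ∑ j, ∑ l, (1 / 2) * X p l * (dg i j l + dg j i l - dg l i j) * v i * v j := by
    rw [Finset.mul_sum]
    refine Finset.sum_congr rfl fun i _ => ?_
    rw [Finset.mul_sum]
    refine Finset.sum_congr rfl fun j _ => ?_
    have : c p * ∑ k, christoffel g k i j p * pderiv k Φ p
        = ∑ l, (1 / 2) * X p l * (dg i j l + dg j i l - dg l i j) := by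
      simp_rw [christoffel, ← hW, Finset.mul_sum, Finset.sum_mul, Finset.mul_sum]
      rw [Finset.sum_comm]
      refine Finset.sum_congr rfl fun l _ => ?_
      refine Finset.sum_congr rfl fun k _ => ?_
      simp only [hdg]
      ring
    rw [← mul_assoc, ← mul_assoc, this, Finset.sum_mul, Finset.sum_mul]
  have e3 : c p * hessian g Φ p v v = c p * (∑ j, ∑ i, H i j * v i * v j)
      - c p * ∑ i, ∑ j, (∑ k, christoffel g k i j p * pderiv k Φ p) * v i * v j := by
    rw [← mul_sub, Finset.sum_comm, ← Finset.sum_sub_distrib]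
    simp_rw [← Finset.sum_sub_distrib, ← sub_mul]
    rfl
  have e4 : ∑ i, ∑ j, ∑ l, (1 / 2) * X p l * (dg i j l + dg j i l - dg l i j) * v i * v j
      = (∑ i, ∑ j, ∑ l, X p l * dg i j l * v i * v j)
        - (1 / 2) * ∑ i, ∑ j, ∑ l, X p l * dg l i j * v i * v j := by
    -- Contraction with the symmetric `v i * v j` makes the first two Christoffel terms equal.
    have hsw : ∑ i, ∑ j, ∑ l, X p l * dg j i l * v i * v j
        = ∑ i, ∑ j, ∑ l, X p l * dg i j l * v i * v j := by
      rw [Finset.sum_comm]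
      refine Finset.sum_congr rfl fun i _ => Finset.sum_congr rfl fun j _ =>
        Finset.sum_congr rfl fun l _ => by ring
    have : ∑ i, ∑ j, ∑ l, (1 / 2) * X p l * (dg i j l + dg j i l - dg l i j) * v i * v j
        = (1 / 2) * (∑ i, ∑ j, ∑ l, X p l * dg i j l * v i * v j)
          + (1 / 2) * (∑ i, ∑ j, ∑ l, X p l * dg j i l * v i * v j)
          - (1 / 2) * ∑ i, ∑ j, ∑ l, X p l * dg l i j * v i * v j := by
      simp_rw [Finset.mul_sum, ← Finset.sum_add_distrib, ← Finset.sum_sub_distrib]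
      refine Finset.sum_congr rfl fun i _ => Finset.sum_congr rfl fun j _ =>
        Finset.sum_congr rfl fun l _ => by ring
    rw [this, hsw]; ring
  have e5 : ∑ j, v j * ∑ l, ((∑ i, v i * dg i j l) * X p l + g p j l * Y l)
      = (∑ i, ∑ j, ∑ l, X p l * dg i j l * v i * v j) + ∑ j, ∑ l, g p j l * v j * Y l := by
    rw [Finset.sum_comm (f := fun i j => ∑ l, X p l * dg i j l * v i * v j),
      ← Finset.sum_add_distrib]
    refine Finset.sum_congr rfl fun j _ => ?_
    rw [Finset.sum_add_distrib, mul_add, Finset.mul_sum, Finset.mul_sum, Finset.sum_comm]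
    congr 1
    · refine Finset.sum_congr rfl fun l _ => ?_
      rw [Finset.sum_mul, Finset.mul_sum]
      exact Finset.sum_congr rfl fun i _ => by ring
    · exact Finset.sum_congr rfl fun l _ => by ring
  have e6 : ∑ i, (Y i * ∑ j, g p i j * v j
        + v i * ∑ j, ((∑ k, X p k * dg k i j) * v j + g p i j * Y j))
      = 2 * (∑ j, ∑ l, g p j l * v j * Y l) + ∑ i, ∑ j, ∑ l, X p l * dg l i j * v i * v j := by
    have h1 : ∑ i, Y i * ∑ j, g p i j * v j = ∑ j, ∑ l, g p j l * v j * Y l := by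
      rw [Finset.sum_comm]
      refine Finset.sum_congr rfl fun i _ => ?_
      rw [Finset.mul_sum]
      exact Finset.sum_congr rfl fun j _ => by rw [hsymm i j]; ring
    have h2 : ∑ i, v i * ∑ j, ((∑ k, X p k * dg k i j) * v j + g p i j * Y j)
        = (∑ i, ∑ j, ∑ l, X p l * dg l i j * v i * v j) + ∑ j, ∑ l, g p j l * v j * Y l := by
      rw [← Finset.sum_add_distrib]
      refine Finset.sum_congr rfl fun i _ => ?_
      rw [Finset.sum_add_distrib, mul_add, Finset.mul_sum, Finset.mul_sum]
      congr 1
      · refine Finset.sum_congr rfl fun j _ => ?_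
        rw [Finset.sum_mul, Finset.mul_sum]
        exact Finset.sum_congr rfl fun l _ => by ring
      · exact Finset.sum_congr rfl fun l _ => by ring
    rw [Finset.sum_add_distrib, h1, h2]; ring
  rw [e3, e2, e4, ← e1, e5, e6]
  ring

theorem pderiv_mul {f h : (Fin n → ℝ) → ℝ} {q : Fin n → ℝ} (hf : DifferentiableAt ℝ f q)
    (hh : DifferentiableAt ℝ h q) (i : Fin n) :
    pderiv i (fun x => f x * h x) q = f q * pderiv i h q + h q * pderiv i f q := by
  simp only [pderiv]
  rw [fderiv_fun_mul hf hh]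
  simp

theorem differentiableAt_pderiv {f : (Fin n → ℝ) → ℝ} {q : Fin n → ℝ} (hf : ContDiffAt ℝ 2 f q)
    (i : Fin n) : DifferentiableAt ℝ (pderiv i f) q := by
  have h : ContDiffAt ℝ 1 (fderiv ℝ f) q := hf.fderiv_right (m := 1) (by norm_num)
  exact (h.differentiableAt (by norm_num)).clm_apply (differentiableAt_const _)

/-- On a vector tangent to the zero set of `f`, the Hessian of `f h` is `h` times that of `f`. -/
theorem hessian_mul_of_eq_zero (g : (Fin n → ℝ) → Matrix (Fin n) (Fin n) ℝ)
    {f h : (Fin n → ℝ) → ℝ} {p v : Fin n → ℝ} (hf : ContDiffAt ℝ 2 f p) (hh : ContDiffAt ℝ 2 h p)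
    (h0 : f p = 0) (hv : ∑ j, v j * pderiv j f p = 0) :
    hessian g (fun x => f x * h x) p v v = h p * hessian g f p v v := by
  have hev : ∀ j, pderiv j (fun x => f x * h x)
      =ᶠ[𝓝 p] fun q => f q * pderiv j h q + h q * pderiv j f q := by
    intro j
    filter_upwards [hf.eventually (by simp), hh.eventually (by simp)] with q h1 h2
    exact pderiv_mul (h1.differentiableAt (by norm_num)) (h2.differentiableAt (by norm_num)) j
  have hfd := hf.differentiableAt (by norm_num)
  have hhd := hh.differentiableAt (by norm_num)
  have h2 : ∀ i j, pderiv i (pderiv j (fun x => f x * h x)) p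
      = pderiv i f p * pderiv j h p + pderiv i h p * pderiv j f p
        + h p * pderiv i (pderiv j f) p := by
    intro i j
    have d1 := differentiableAt_pderiv hf j
    have d2 := differentiableAt_pderiv hh j
    have : pderiv i (pderiv j (fun x => f x * h x)) p
        = pderiv i (fun q => f q * pderiv j h q) p + pderiv i (fun q => h q * pderiv j f q) p := by
      rw [pderiv, (hev j).fderiv_eq, fderiv_fun_add (hfd.fun_mul d2) (hhd.fun_mul d1)]
      rfl
    rw [this, pderiv_mul hfd d2, pderiv_mul hhd d1, h0]
    ring
  have h1 : ∀ k, pderiv k (fun x => f x * h x) p = h p * pderiv k f p := by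
    intro k; rw [pderiv_mul hfd hhd, h0]; ring
  have key : hessian g (fun x => f x * h x) p v v
      = (∑ i, ∑ j, (pderiv i f p * v i) * (pderiv j h p * v j))
        + (∑ i, ∑ j, (pderiv i h p * v i) * (pderiv j f p * v j))
        + h p * hessian g f p v v := by
    simp only [hessian]
    rw [Finset.mul_sum, ← Finset.sum_add_distrib, ← Finset.sum_add_distrib]
    refine Finset.sum_congr rfl fun i _ => ?_
    rw [Finset.mul_sum, ← Finset.sum_add_distrib, ← Finset.sum_add_distrib]
    refine Finset.sum_congr rfl fun j _ => ?_
    rw [h2]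
    simp_rw [h1]
    have : ∑ k, christoffel g k i j p * (h p * pderiv k f p)
        = h p * ∑ k, christoffel g k i j p * pderiv k f p := by
      rw [Finset.mul_sum]; exact Finset.sum_congr rfl fun k _ => by ring
    rw [this]; ring
  have hv' : ∑ j, pderiv j f p * v j = 0 := by
    rw [← hv]; exact Finset.sum_congr rfl fun k _ => by ring
  rw [key]
  simp_rw [← Finset.mul_sum, ← Finset.sum_mul, hv']
  simp

end General

/-! ### The radial coordinate and the polar angle -/

theorem radius_nonneg (x : Fin 3 → ℝ) : 0 ≤ radius x := Real.sqrt_nonneg _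

theorem radius_sq (x : Fin 3 → ℝ) : radius x ^ 2 = x 0 ^ 2 + x 1 ^ 2 + x 2 ^ 2 :=
  Real.sq_sqrt (by positivity)

theorem cosTheta_mul_radius {x : Fin 3 → ℝ} (hx : 0 < radius x) :
    cosTheta x * radius x = x 2 := div_mul_cancel₀ _ hx.ne'

theorem cosTheta_sq_le_one (x : Fin 3 → ℝ) : cosTheta x ^ 2 ≤ 1 := by
  rw [cosTheta, div_pow]
  refine div_le_one_of_le₀ ?_ (sq_nonneg _)
  rw [radius_sq]
  nlinarith [sq_nonneg (x 0), sq_nonneg (x 1)]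

theorem contDiffAt_radius {x : Fin 3 → ℝ} (hx : 0 < radius x) {k : WithTop ℕ∞} :
    ContDiffAt ℝ k radius x := by
  refine ContDiffAt.sqrt (by fun_prop) ?_
  rw [← radius_sq]
  positivity

theorem contDiffAt_cosTheta {x : Fin 3 → ℝ} (hx : 0 < radius x) {k : WithTop ℕ∞} :
    ContDiffAt ℝ k cosTheta x :=
  ContDiffAt.div (by fun_prop) (contDiffAt_radius hx) hx.ne'

theorem contDiff_space {k : WithTop ℕ∞} : ContDiff ℝ k space := by
  unfold space
  fun_prop

theorem continuous_radius : Continuous radius := by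
  unfold radius
  fun_prop

theorem hasDerivAt_radius {γ : ℝ → Fin 3 → ℝ} {w : Fin 3 → ℝ} {t : ℝ}
    (hγ : ∀ i, HasDerivAt (fun h => γ h i) (w i) t) (hr : 0 < radius (γ t)) :
    HasDerivAt (fun h => radius (γ h))
      ((γ t 0 * w 0 + γ t 1 * w 1 + γ t 2 * w 2) / radius (γ t)) t := by
  have h := ((((hγ 0).fun_pow 2).fun_add ((hγ 1).fun_pow 2)).fun_add ((hγ 2).fun_pow 2)).sqrt
    (by rw [← radius_sq]; positivity)
  unfold radius
  refine h.congr_deriv ?_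
  norm_num
  ring

theorem hasDerivAt_cosTheta {γ : ℝ → Fin 3 → ℝ} {w : Fin 3 → ℝ} {t : ℝ}
    (hγ : ∀ i, HasDerivAt (fun h => γ h i) (w i) t) (hr : 0 < radius (γ t)) :
    HasDerivAt (fun h => cosTheta (γ h))
      ((w 2 - cosTheta (γ t) * ((γ t 0 * w 0 + γ t 1 * w 1 + γ t 2 * w 2) / radius (γ t)))
        / radius (γ t)) t := by
  unfold cosTheta
  refine ((hγ 2).fun_div (hasDerivAt_radius hγ hr) hr.ne').congr_deriv ?_
  field_simp

/-! ### The potentials -/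

/-- The function `r² - 2 μ r + b cos² θ - k`. -/
def potential (μ b k : ℝ) (x : Fin 3 → ℝ) : ℝ :=
  radius x ^ 2 - 2 * μ * radius x + b * cosTheta x ^ 2 - k

theorem contDiffAt_potential (μ b k : ℝ) {x : Fin 3 → ℝ} (hx : 0 < radius x) {l : WithTop ℕ∞} :
    ContDiffAt ℝ l (potential μ b k) x := by
  have h1 := contDiffAt_radius hx (k := l)
  have h2 := contDiffAt_cosTheta hx (k := l)
  unfold potential
  fun_prop

theorem hasDerivAt_potential (μ b k : ℝ) {γ : ℝ → Fin 3 → ℝ} {w : Fin 3 → ℝ} {t : ℝ}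
    (hγ : ∀ i, HasDerivAt (fun h => γ h i) (w i) t) (hr : 0 < radius (γ t)) :
    HasDerivAt (fun h => potential μ b k (γ h))
      (2 * (radius (γ t) - μ) * ((γ t 0 * w 0 + γ t 1 * w 1 + γ t 2 * w 2) / radius (γ t))
        + 2 * b * cosTheta (γ t) * ((w 2 - cosTheta (γ t) *
          ((γ t 0 * w 0 + γ t 1 * w 1 + γ t 2 * w 2) / radius (γ t))) / radius (γ t))) t := by
  unfold potential
  have h1 := hasDerivAt_radius hγ hr
  have h2 := hasDerivAt_cosTheta hγ hr
  refine ((((h1.fun_pow 2).fun_sub (h1.const_mul (2 * μ))).fun_add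
    ((h2.fun_pow 2).const_mul b)).sub_const k).congr_deriv ?_
  push_cast
  ring

theorem hasDerivAt_line_apply {n : ℕ} (x w : Fin n → ℝ) (i : Fin n) (t : ℝ) :
    HasDerivAt (fun h : ℝ => (x + h • w) i) (w i) t := by
  simpa using ((hasDerivAt_id t).mul_const (w i)).const_add (x i)

theorem fderiv_potential (μ b k : ℝ) {x : Fin 3 → ℝ} (hx : 0 < radius x) (w : Fin 3 → ℝ) :
    fderiv ℝ (potential μ b k) x w =
      2 * (radius x - μ) * ((x 0 * w 0 + x 1 * w 1 + x 2 * w 2) / radius x)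
        + 2 * b * cosTheta x * ((w 2 - cosTheta x *
          ((x 0 * w 0 + x 1 * w 1 + x 2 * w 2) / radius x)) / radius x) := by
  have hd := (contDiffAt_potential μ b k hx (l := 1)).differentiableAt (by norm_num)
  have h1 := hasDerivAt_comp_line hd w
  rw [← fderiv_apply_eq_sum_pderiv] at h1
  have h2 := hasDerivAt_potential μ b k (γ := fun h => x + h • w) (w := w) (t := 0)
    (fun i => hasDerivAt_line_apply x w i 0) (by simpa using hx)
  simpa using h1.unique h2

theorem fderiv_comp_space {f : (Fin 3 → ℝ) → ℝ} {p : Fin 4 → ℝ}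
    (hf : DifferentiableAt ℝ f (space p)) (v : Fin 4 → ℝ) :
    fderiv ℝ (fun q => f (space q)) p v = fderiv ℝ f (space p) (space v) := by
  let L : (Fin 4 → ℝ) →L[ℝ] (Fin 3 → ℝ) :=
    ContinuousLinearMap.pi fun i => ContinuousLinearMap.proj i.castSucc
  have hL : space = L := rfl
  have h : HasFDerivAt (fun q => f (space q)) ((fderiv ℝ f (space p)).comp L) p := by
    rw [hL]
    exact (hL ▸ hf.hasFDerivAt).comp p L.hasFDerivAt
  rw [h.fderiv]
  rfl

/-! ### The Kerr metric -/

theorem kerrMetric_mulVec (m a : ℝ) (p w : Fin 4 → ℝ) (j : Fin 4) :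
    (kerrMetric m a p *ᵥ w) j =
      kerrRhoSq a (space p) / kerrDelta m a (space p) * (formDr (space p) ⬝ᵥ w) * formDr (space p) j
        + kerrRhoSq a (space p) / radius (space p) ^ 2 *
          (![w 0, w 1, w 2, 0] j - (formDr (space p) ⬝ᵥ w) * formDr (space p) j)
        + a ^ 2 * (1 + 2 * m * radius (space p) / kerrRhoSq a (space p)) *
          (formSinSqDphi (space p) ⬝ᵥ w) * formSinSqDphi (space p) j
        - 2 * m * radius (space p) * a / kerrRhoSq a (space p) *
          (formSinSqDphi (space p) j * w 3 + (formSinSqDphi (space p) ⬝ᵥ w) * formDt j)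
        - (1 - 2 * m * radius (space p) / kerrRhoSq a (space p)) * w 3 * formDt j := by
  have hE : (euclid *ᵥ w) j = ![w 0, w 1, w 2, 0] j := by
    fin_cases j <;> simp [euclid, Matrix.mulVec_diagonal]
  have hT : formDt ⬝ᵥ w = w 3 := by
    simp [formDt, dotProduct, Fin.sum_univ_four]
  have hV : ∀ u z : Fin 4 → ℝ, (Matrix.vecMulVec u z *ᵥ w) j = u j * (z ⬝ᵥ w) := by
    intro u z
    simp [Matrix.mulVec, Matrix.vecMulVec, dotProduct, Fin.sum_univ_four]
    ring
  simp only [kerrMetric, Matrix.add_mulVec, Matrix.sub_mulVec, Matrix.smul_mulVec,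
    Pi.add_apply, Pi.sub_apply, Pi.smul_apply, hE, hV, hT, smul_eq_mul]
  ring

theorem kerrMetric_symm (m a : ℝ) (p : Fin 4 → ℝ) (i j : Fin 4) :
    kerrMetric m a p i j = kerrMetric m a p j i := by
  have hE : euclid i j = euclid j i := by
    simp only [euclid, Matrix.diagonal_apply]
    by_cases h : i = j
    · subst h; rfl
    · simp [h, Ne.symm h]
  simp only [kerrMetric, Matrix.add_apply, Matrix.sub_apply, Matrix.smul_apply,
    Matrix.vecMulVec_apply, hE, smul_eq_mul]
  ring

theorem kerrRhoSq_pos (a : ℝ) {x : Fin 3 → ℝ} (hx : 0 < radius x) : 0 < kerrRhoSq a x := by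
  unfold kerrRhoSq
  positivity

theorem formDr_dotProduct (x : Fin 3 → ℝ) (v : Fin 4 → ℝ) :
    formDr x ⬝ᵥ v = (x 0 * v 0 + x 1 * v 1 + x 2 * v 2) / radius x := by
  simp [formDr, dotProduct, Fin.sum_univ_four]
  ring

theorem formSinSqDphi_dotProduct (x : Fin 3 → ℝ) (v : Fin 4 → ℝ) :
    formSinSqDphi x ⬝ᵥ v = (x 0 * v 1 - x 1 * v 0) / radius x ^ 2 := by
  simp [formSinSqDphi, dotProduct, Fin.sum_univ_four]
  ring

theorem formDr_dotProduct_sq_le {x : Fin 3 → ℝ} (hx : 0 < radius x) (v : Fin 4 → ℝ) :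
    (formDr x ⬝ᵥ v) ^ 2 ≤ v 0 ^ 2 + v 1 ^ 2 + v 2 ^ 2 := by
  rw [formDr_dotProduct, div_pow, div_le_iff₀ (by positivity), radius_sq]
  nlinarith [sq_nonneg (x 0 * v 1 - x 1 * v 0), sq_nonneg (x 0 * v 2 - x 2 * v 0),
    sq_nonneg (x 1 * v 2 - x 2 * v 1)]

theorem kerrMetric_det_ne_zero {m a : ℝ} (hm : 0 < m) {p : Fin 4 → ℝ}
    (hr : 0 < radius (space p)) (hΔ : 0 < kerrDelta m a (space p))
    (hρ : 2 * m * radius (space p) < kerrRhoSq a (space p)) : (kerrMetric m a p).det ≠ 0 := by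
  intro hdet
  obtain ⟨w, hw0, hw⟩ := Matrix.exists_mulVec_eq_zero_iff.2 hdet
  have hρ0 := kerrRhoSq_pos a hr
  have hcs := formDr_dotProduct_sq_le hr w
  -- Pairing a kernel vector with its time reflection cancels the mixed `dt` terms. What remains is
  -- a sum of terms that are nonnegative outside the ergosurface, so each vanishes.
  have h0 : ![w 0, w 1, w 2, -w 3] ⬝ᵥ (kerrMetric m a p *ᵥ w) = 0 := by rw [hw]; simp
  have h1 : ![w 0, w 1, w 2, -w 3] ⬝ᵥ (kerrMetric m a p *ᵥ w) =
      kerrRhoSq a (space p) / kerrDelta m a (space p) * (formDr (space p) ⬝ᵥ w) ^ 2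
        + kerrRhoSq a (space p) / radius (space p) ^ 2 *
          (w 0 ^ 2 + w 1 ^ 2 + w 2 ^ 2 - (formDr (space p) ⬝ᵥ w) ^ 2)
        + a ^ 2 * (1 + 2 * m * radius (space p) / kerrRhoSq a (space p)) *
          (formSinSqDphi (space p) ⬝ᵥ w) ^ 2
        + (1 - 2 * m * radius (space p) / kerrRhoSq a (space p)) * w 3 ^ 2 := by
    have hD : formDr (space p) ⬝ᵥ w = formDr (space p) 0 * w 0 + formDr (space p) 1 * w 1
        + formDr (space p) 2 * w 2 := by
      simp [formDr, dotProduct, Fin.sum_univ_four]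
    have hS : formSinSqDphi (space p) ⬝ᵥ w = formSinSqDphi (space p) 0 * w 0
        + formSinSqDphi (space p) 1 * w 1 := by
      simp [formSinSqDphi, dotProduct, Fin.sum_univ_four]
    have hd3 : formDr (space p) 3 = 0 := rfl
    have hs2 : formSinSqDphi (space p) 2 = 0 := rfl
    have hs3 : formSinSqDphi (space p) 3 = 0 := rfl
    have hsum : ∀ y z : Fin 4 → ℝ, y ⬝ᵥ z = y 0 * z 0 + y 1 * z 1 + y 2 * z 2 + y 3 * z 3 :=
      fun y z => Fin.sum_univ_four _
    rw [hsum]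
    simp only [kerrMetric_mulVec, hd3, hs2, hs3, hD, hS]
    simp [formDt]
    ring
  rw [h1] at h0
  have hf : 0 < 1 - 2 * m * radius (space p) / kerrRhoSq a (space p) := by
    rw [sub_pos, div_lt_one hρ0]; exact hρ
  have t1 : 0 ≤ kerrRhoSq a (space p) / kerrDelta m a (space p) * (formDr (space p) ⬝ᵥ w) ^ 2 := by
    positivity
  have t2 : 0 ≤ kerrRhoSq a (space p) / radius (space p) ^ 2 *
      (w 0 ^ 2 + w 1 ^ 2 + w 2 ^ 2 - (formDr (space p) ⬝ᵥ w) ^ 2) :=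
    mul_nonneg (by positivity) (sub_nonneg.2 hcs)
  have t3 : 0 ≤ a ^ 2 * (1 + 2 * m * radius (space p) / kerrRhoSq a (space p)) *
      (formSinSqDphi (space p) ⬝ᵥ w) ^ 2 := by positivity
  have t4 : 0 ≤ (1 - 2 * m * radius (space p) / kerrRhoSq a (space p)) * w 3 ^ 2 := by positivity
  have z1 : (formDr (space p) ⬝ᵥ w) ^ 2 = 0 := by
    have : kerrRhoSq a (space p) / kerrDelta m a (space p) * (formDr (space p) ⬝ᵥ w) ^ 2 = 0 := by
      linarith
    exact (mul_eq_zero.1 this).resolve_left (by positivity)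
  have z2 : w 0 ^ 2 + w 1 ^ 2 + w 2 ^ 2 = 0 := by
    have : kerrRhoSq a (space p) / radius (space p) ^ 2 *
      (w 0 ^ 2 + w 1 ^ 2 + w 2 ^ 2 - (formDr (space p) ⬝ᵥ w) ^ 2) = 0 := by linarith
    have := (mul_eq_zero.1 this).resolve_left (by positivity)
    linarith
  have z3 : w 3 ^ 2 = 0 := by
    have : (1 - 2 * m * radius (space p) / kerrRhoSq a (space p)) * w 3 ^ 2 = 0 := by linarith
    exact (mul_eq_zero.1 this).resolve_left hf.ne'
  apply hw0
  ext i
  have a0 := sq_nonneg (w 0)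
  have a1 := sq_nonneg (w 1)
  have a2 := sq_nonneg (w 2)
  refine pow_eq_zero_iff two_ne_zero |>.1 ?_
  fin_cases i
  · change w 0 ^ 2 = 0; linarith
  · change w 1 ^ 2 = 0; linarith
  · change w 2 ^ 2 = 0; linarith
  · exact z3

theorem differentiableAt_kerrMetric {m a : ℝ} {p : Fin 4 → ℝ} (hr : 0 < radius (space p))
    (hΔ : kerrDelta m a (space p) ≠ 0) (i j : Fin 4) :
    DifferentiableAt ℝ (fun q => kerrMetric m a q i j) p := by
  have hsp : DifferentiableAt ℝ space p := (contDiff_space (k := 1)).differentiable (by norm_num) p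
  have dr : DifferentiableAt ℝ (fun q : Fin 4 → ℝ => radius (space q)) p :=
    DifferentiableAt.comp (f := space) p ((contDiffAt_radius hr (k := 1)).differentiableAt (by norm_num)) hsp
  have dc : DifferentiableAt ℝ (fun q : Fin 4 → ℝ => cosTheta (space q)) p :=
    DifferentiableAt.comp (f := space) p ((contDiffAt_cosTheta hr (k := 1)).differentiableAt (by norm_num)) hsp
  have dρ : DifferentiableAt ℝ (fun q : Fin 4 → ℝ => kerrRhoSq a (space q)) p := by
    unfold kerrRhoSq; fun_prop
  have dΔ : DifferentiableAt ℝ (fun q : Fin 4 → ℝ => kerrDelta m a (space q)) p := by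
    unfold kerrDelta; fun_prop
  have hρ := (kerrRhoSq_pos a hr).ne'
  have hr2 : radius (space p) ^ 2 ≠ 0 := by positivity
  have dx : ∀ k : Fin 3, DifferentiableAt ℝ (fun q : Fin 4 → ℝ => space q k) p := fun k => by
    unfold space; fun_prop
  have dDr : ∀ k, DifferentiableAt ℝ (fun q : Fin 4 → ℝ => formDr (space q) k) p := by
    intro k
    fin_cases k
    · exact (dx 0).mul (dr.inv hr.ne')
    · exact (dx 1).mul (dr.inv hr.ne')
    · exact (dx 2).mul (dr.inv hr.ne')
    · exact differentiableAt_const _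
  have dS : ∀ k, DifferentiableAt ℝ (fun q : Fin 4 → ℝ => formSinSqDphi (space q) k) p := by
    intro k
    fin_cases k
    · exact (dx 1).neg.mul ((dr.pow 2).inv hr2)
    · exact (dx 0).mul ((dr.pow 2).inv hr2)
    · exact differentiableAt_const _
    · exact differentiableAt_const _
  simp only [kerrMetric, Matrix.add_apply, Matrix.sub_apply, Matrix.smul_apply,
    Matrix.vecMulVec_apply, smul_eq_mul]
  have e1 := dDr i
  have e2 := dDr j
  have e3 := dS i
  have e4 := dS j
  fun_prop (disch := assumption)

/-! ### The gradient of a potential and the Lie derivative of the Kerr metric along it -/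

/-- The factor `κ = Δ (1 - μ / r) - b cos² θ`. -/
def gradFactor (m a μ b : ℝ) (x : Fin 3 → ℝ) : ℝ :=
  kerrDelta m a x * (1 - μ / radius x) - b * cosTheta x ^ 2

/-- The vector field `Δ (r - μ) ∂_r + b cos θ sin² θ ∂_{cos θ}`; it is `ρ² / 2` times the gradient
of `r² - 2 μ r + b cos² θ`. -/
def gradField (m a μ b : ℝ) (p : Fin 4 → ℝ) : Fin 4 → ℝ :=
  ![gradFactor m a μ b (space p) * p 0, gradFactor m a μ b (space p) * p 1,
    (gradFactor m a μ b (space p) + b) * p 2, 0]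

theorem pderiv_potential (μ b k : ℝ) {p : Fin 4 → ℝ} (hr : 0 < radius (space p)) (j : Fin 4) :
    pderiv j (fun q => potential μ b k (space q)) p =
      2 * (radius (space p) - μ) * formDr (space p) j
        + 2 * b * cosTheta (space p) *
          ((![0, 0, 1, 0] j - cosTheta (space p) * formDr (space p) j) / radius (space p)) := by
  rw [pderiv, fderiv_comp_space ((contDiffAt_potential μ b k hr (l := 1)).differentiableAt
    (by norm_num)), fderiv_potential μ b k hr]
  fin_cases j <;> simp [space, formDr]

theorem kerrMetric_mulVec_gradField (m a μ b k : ℝ) {p : Fin 4 → ℝ} (hr : 0 < radius (space p))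
    (hΔ : kerrDelta m a (space p) ≠ 0) (j : Fin 4) :
    (kerrMetric m a p *ᵥ gradField m a μ b p) j =
      kerrRhoSq a (space p) / 2 * pderiv j (fun q => potential μ b k (space q)) p := by
  have hr2 : radius (space p) ^ 2 = p 0 ^ 2 + p 1 ^ 2 + p 2 ^ 2 := radius_sq _
  have hz : cosTheta (space p) * radius (space p) = p 2 := cosTheta_mul_radius hr
  have hD : formDr (space p) ⬝ᵥ gradField m a μ b p
      = kerrDelta m a (space p) * (radius (space p) - μ) := by
    rw [formDr_dotProduct]
    simp only [gradField, gradFactor]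
    change (p 0 * (_ * p 0) + p 1 * (_ * p 1) + p 2 * (_ * p 2)) / _ = _
    have h01 : p 0 ^ 2 + p 1 ^ 2 = radius (space p) ^ 2 - (cosTheta (space p) * radius (space p)) ^ 2 := by
      rw [hz]; linarith
    rw [← hz]
    field_simp
    linear_combination (kerrDelta m a (space p) * (radius (space p) - μ)
      - b * cosTheta (space p) ^ 2 * radius (space p)) * h01
  have hS : formSinSqDphi (space p) ⬝ᵥ gradField m a μ b p = 0 := by
    rw [formSinSqDphi_dotProduct]
    simp only [gradField]
    change (p 0 * (_ * p 1) - p 1 * (_ * p 0)) / _ = 0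
    ring
  have h3 : gradField m a μ b p 3 = 0 := rfl
  rw [kerrMetric_mulVec, hD, hS, h3, pderiv_potential μ b k hr]
  -- Splits the spatial part of the field into its radial component and a multiple of the Euclidean
  -- gradient `(e_z - cos θ dr) / r` of `cos θ`, the same two covectors that make up the
  -- differential of the potential.
  have key : ![gradField m a μ b p 0, gradField m a μ b p 1, gradField m a μ b p 2, 0] j
      = kerrDelta m a (space p) * (radius (space p) - μ) * formDr (space p) j
        + b * cosTheta (space p) * radius (space p) *
          (![0, 0, 1, 0] j - cosTheta (space p) * formDr (space p) j) := by
    fin_cases j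
    · change _ * p 0 = _ * (p 0 / _) + _ * (0 - _ * (p 0 / _))
      rw [gradFactor]; field_simp; ring
    · change _ * p 1 = _ * (p 1 / _) + _ * (0 - _ * (p 1 / _))
      rw [gradFactor]; field_simp; ring
    · change _ * p 2 = _ * (p 2 / _) + _ * (1 - _ * (p 2 / _))
      rw [gradFactor, ← hz]; field_simp; ring
    · change (0 : ℝ) = _ * 0 + _ * (0 - _ * 0)
      ring
  rw [key]
  field_simp
  ring

/-- The value of the Lie derivative of the Kerr metric along `gradField` on a vector with
`dr = u`, `sin² θ dφ = s`, `dt = τ` and `dθ² + sin² θ dφ² = q`. -/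
def lieForm (m a μ b r c u s τ q : ℝ) : ℝ :=
  let Δ := r ^ 2 - 2 * m * r + a ^ 2
  let ρ := r ^ 2 + a ^ 2 * c ^ 2
  let A := Δ * (r - μ)
  let ρ' := 2 * r * A + 2 * a ^ 2 * c * (b * c * (1 - c ^ 2))
  let f := 2 * m * r / ρ
  let f' := 2 * m * (A * ρ - r * ρ') / ρ ^ 2
  let s' := -2 * b * c ^ 2 * s
  (ρ' * Δ - ρ * ((2 * r - 2 * m) * A)) / Δ ^ 2 * u ^ 2
    + 2 * (ρ / Δ) * ((2 * r - 2 * m) * (r - μ) + Δ) * u ^ 2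
    + ρ' * q + ρ * (2 * b * (1 - 2 * c ^ 2) * q - 2 * b * s ^ 2)
    + a ^ 2 * (f' * s ^ 2 + (1 + f) * (2 * s * s')) - 2 * a * (f' * s + f * s') * τ + f' * τ ^ 2

/-- The rate of change of the Kerr quadratic form in terms of those of its ingredients. -/
theorem hasDerivAt_kerrQuadratic {m a : ℝ} {r c U s P : ℝ → ℝ} {r' c' U' s' P' τ t q q' : ℝ}
    (hr : HasDerivAt r r' t) (hc : HasDerivAt c c' t) (hU : HasDerivAt U U' t)
    (hs : HasDerivAt s s' t) (hP : HasDerivAt P P' t) (hr0 : 0 < r t)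
    (hΔ : r t ^ 2 - 2 * m * r t + a ^ 2 ≠ 0)
    (hq : P t - U t ^ 2 = r t ^ 2 * q)
    (hq' : P' - 2 * (U t * U') = 2 * (r t * r') * q + r t ^ 2 * q') :
    HasDerivAt (fun h => (r h ^ 2 + a ^ 2 * c h ^ 2) / (r h ^ 2 - 2 * m * r h + a ^ 2) * U h ^ 2
        + (r h ^ 2 + a ^ 2 * c h ^ 2) / r h ^ 2 * (P h - U h ^ 2)
        + a ^ 2 * (1 + 2 * m * r h / (r h ^ 2 + a ^ 2 * c h ^ 2)) * s h ^ 2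
        - 4 * m * r h * a / (r h ^ 2 + a ^ 2 * c h ^ 2) * (s h * τ)
        - (1 - 2 * m * r h / (r h ^ 2 + a ^ 2 * c h ^ 2)) * τ ^ 2)
      (((2 * r t * r' + 2 * a ^ 2 * c t * c') * (r t ^ 2 - 2 * m * r t + a ^ 2)
          - (r t ^ 2 + a ^ 2 * c t ^ 2) * ((2 * r t - 2 * m) * r'))
            / (r t ^ 2 - 2 * m * r t + a ^ 2) ^ 2 * U t ^ 2
        + 2 * ((r t ^ 2 + a ^ 2 * c t ^ 2) / (r t ^ 2 - 2 * m * r t + a ^ 2)) * (U t * U')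
        + (2 * r t * r' + 2 * a ^ 2 * c t * c') * q + (r t ^ 2 + a ^ 2 * c t ^ 2) * q'
        + a ^ 2 * (2 * m * (r' * (r t ^ 2 + a ^ 2 * c t ^ 2)
              - r t * (2 * r t * r' + 2 * a ^ 2 * c t * c')) / (r t ^ 2 + a ^ 2 * c t ^ 2) ^ 2 * s t ^ 2
            + (1 + 2 * m * r t / (r t ^ 2 + a ^ 2 * c t ^ 2)) * (2 * s t * s'))
        - 2 * a * (2 * m * (r' * (r t ^ 2 + a ^ 2 * c t ^ 2)
              - r t * (2 * r t * r' + 2 * a ^ 2 * c t * c')) / (r t ^ 2 + a ^ 2 * c t ^ 2) ^ 2 * s t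
            + 2 * m * r t / (r t ^ 2 + a ^ 2 * c t ^ 2) * s') * τ
        + 2 * m * (r' * (r t ^ 2 + a ^ 2 * c t ^ 2)
              - r t * (2 * r t * r' + 2 * a ^ 2 * c t * c')) / (r t ^ 2 + a ^ 2 * c t ^ 2) ^ 2
            * τ ^ 2) t := by
  have hρ0 : r t ^ 2 + a ^ 2 * c t ^ 2 ≠ 0 := by positivity
  have hr2 : r t ^ 2 ≠ 0 := by positivity
  have hρ := (hr.fun_pow 2).fun_add ((hc.fun_pow 2).const_mul (a ^ 2))
  have hD := ((hr.fun_pow 2).fun_sub (hr.const_mul (2 * m))).add_const (a ^ 2)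
  have hf := (hr.const_mul (2 * m)).fun_div hρ hρ0
  have h1 := (hρ.fun_div hD hΔ).fun_mul (hU.fun_pow 2)
  have h2 := (hρ.fun_div (hr.fun_pow 2) hr2).fun_mul (hP.fun_sub (hU.fun_pow 2))
  have h3 := ((hf.const_add 1).const_mul (a ^ 2)).fun_mul (hs.fun_pow 2)
  have h4 := (((hr.const_mul (4 * m)).mul_const a).fun_div hρ hρ0).fun_mul (hs.mul_const τ)
  have h5 := (hf.const_sub 1).mul_const (τ ^ 2)
  refine ((((h1.fun_add h2).fun_add h3).fun_sub h4).fun_sub h5).congr_deriv ?_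
  -- Trading the Euclidean square `P` for the spherical part `q` turns the coefficient `ρ²/r²` into
  -- `ρ²`.
  have hP : P t = U t ^ 2 + r t ^ 2 * q := by linarith
  have hP' : P' = 2 * (U t * U') + 2 * (r t * r') * q + r t ^ 2 * q' := by linarith
  rw [hP, hP']
  generalize r t = R at *
  generalize c t = C at *
  generalize U t = V at *
  generalize s t = S at *
  have hΔ' : R ^ 2 - 2 * m * R + a ^ 2 ≠ 0 := hΔ
  have e1 : (R ^ 2 + a ^ 2 * C ^ 2) / R ^ 2 * (2 * (V * U') + 2 * (R * r') * q + R ^ 2 * q' - 2 * (V * U'))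
     + (((2 * R * r' + a ^ 2 * (2 * C * c')) * R ^ 2 - (R ^ 2 + a ^ 2 * C ^ 2) * (2 * R * r'))
        / (R ^ 2) ^ 2) * (R ^ 2 * q)
     = (2 * R * r' + 2 * a ^ 2 * C * c') * q + (R ^ 2 + a ^ 2 * C ^ 2) * q' := by
    field_simp
    ring
  have e2 : (4 * m * r' * a * (R ^ 2 + a ^ 2 * C ^ 2)
        - 4 * m * R * a * (2 * R * r' + a ^ 2 * (2 * C * c'))) / (R ^ 2 + a ^ 2 * C ^ 2) ^ 2
      = 2 * a * (2 * m * (r' * (R ^ 2 + a ^ 2 * C ^ 2)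
              - R * (2 * R * r' + 2 * a ^ 2 * C * c')) / (R ^ 2 + a ^ 2 * C ^ 2) ^ 2) := by
    ring
  norm_num
  linear_combination e1 - S * τ * e2

/-- The value of `dθ² + sin² θ dφ²` on a vector. -/
def sphereSq (x : Fin 3 → ℝ) (v : Fin 4 → ℝ) : ℝ :=
  (v 0 ^ 2 + v 1 ^ 2 + v 2 ^ 2 - (formDr x ⬝ᵥ v) ^ 2) / radius x ^ 2

/-- The value of `d(cos θ)` on a vector. -/
def dCosTheta (x : Fin 3 → ℝ) (v : Fin 4 → ℝ) : ℝ :=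
  (v 2 - cosTheta x * (formDr x ⬝ᵥ v)) / radius x

theorem sphereSq_nonneg {x : Fin 3 → ℝ} (hx : 0 < radius x) (v : Fin 4 → ℝ) :
    0 ≤ sphereSq x v :=
  div_nonneg (sub_nonneg.2 (formDr_dotProduct_sq_le hx v)) (sq_nonneg _)

/-- In spherical coordinates `d(cos θ) = -sin θ dθ`, so both sides are `sin² θ (dθ² + sin² θ dφ²)`;
the Cartesian form also covers the axis. It bounds both one-forms by the round metric. -/
theorem dCosTheta_sq_add_sq {x : Fin 3 → ℝ} (hx : 0 < radius x) (v : Fin 4 → ℝ) :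
    dCosTheta x v ^ 2 + (formSinSqDphi x ⬝ᵥ v) ^ 2 = (1 - cosTheta x ^ 2) * sphereSq x v := by
  have hr2 := radius_sq x
  rw [dCosTheta, sphereSq, formDr_dotProduct, formSinSqDphi_dotProduct, cosTheta]
  generalize radius x = r at *
  have h01 : x 0 ^ 2 = r ^ 2 - x 1 ^ 2 - x 2 ^ 2 := by linarith
  field_simp
  set M := x 0 * v 0 + x 1 * v 1 + x 2 * v 2 with hM
  have h : (x 0 * v 1 - x 1 * v 0) ^ 2 + (M - x 2 * v 2) ^ 2
      = (r ^ 2 - x 2 ^ 2) * (v 0 ^ 2 + v 1 ^ 2) := by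
    rw [hM]; linear_combination -(v 0 ^ 2 + v 1 ^ 2) * hr2
  linear_combination r ^ 2 * h

/-- The terms carrying `2mr/ρ²` combine into the single square `(dt - a sin² θ dφ)²`, which matches
`kerrForm`. -/
theorem kerrMetric_quadratic_eq {m a : ℝ} {p v : Fin 4 → ℝ} (hr : 0 < radius (space p)) :
    v ⬝ᵥ (kerrMetric m a p *ᵥ v) =
      kerrRhoSq a (space p) / kerrDelta m a (space p) * (formDr (space p) ⬝ᵥ v) ^ 2
        + kerrRhoSq a (space p) * sphereSq (space p) v
        + a ^ 2 * (formSinSqDphi (space p) ⬝ᵥ v) ^ 2 - v 3 ^ 2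
        + 2 * m * radius (space p) / kerrRhoSq a (space p)
          * (v 3 - a * (formSinSqDphi (space p) ⬝ᵥ v)) ^ 2 := by
  rw [kerrMetric_quadratic, sphereSq]
  field_simp
  ring

theorem hasDerivAt_gradField {m a μ b : ℝ} {p : Fin 4 → ℝ} (hr : 0 < radius (space p))
    (v : Fin 4 → ℝ) {κ κ' : ℝ} (hκ : κ = gradFactor m a μ b (space p))
    (hκ' : κ' = (2 * radius (space p) - 2 * m) * (1 - μ / radius (space p))
          * (formDr (space p) ⬝ᵥ v)
        + kerrDelta m a (space p) * μ / radius (space p) ^ 2 * (formDr (space p) ⬝ᵥ v)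
        - 2 * b * cosTheta (space p) * dCosTheta (space p) v) :
    HasDerivAt (fun h : ℝ => gradField m a μ b (p + h • v))
      ![κ * v 0 + κ' * p 0, κ * v 1 + κ' * p 1, (κ + b) * v 2 + κ' * p 2, 0] 0 := by
  have hγ : ∀ i, HasDerivAt (fun h : ℝ => space (p + h • v) i) (space v i) 0 :=
    fun i => hasDerivAt_line_apply p v i.castSucc 0
  have hp0 : p + (0 : ℝ) • v = p := by simp
  have hR := hasDerivAt_radius hγ (by rw [hp0]; exact hr)
  have hC := hasDerivAt_cosTheta hγ (by rw [hp0]; exact hr)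
  have hu : (space p 0 * space v 0 + space p 1 * space v 1 + space p 2 * space v 2)
      / radius (space p) = formDr (space p) ⬝ᵥ v := (formDr_dotProduct _ _).symm
  have hd : (space v 2 - cosTheta (space p) * (formDr (space p) ⬝ᵥ v)) / radius (space p)
    = dCosTheta (space p) v := rfl
  rw [hp0, hu] at hR
  rw [hp0, hu, hd] at hC
  have hr' : radius (space (p + (0 : ℝ) • v)) ≠ 0 := by rw [hp0]; exact hr.ne'
  have hκd : HasDerivAt (fun h : ℝ => gradFactor m a μ b (space (p + h • v))) κ' 0 := by
    have hD := ((hR.fun_pow 2).fun_sub (hR.const_mul (2 * m))).add_const (a ^ 2)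
    have hF := (((hasDerivAt_const (0 : ℝ) μ).fun_div hR hr').const_sub 1)
    refine ((hD.fun_mul hF).fun_sub ((hC.fun_pow 2).const_mul b)).congr_deriv ?_
    rw [hp0, hκ', kerrDelta]
    field_simp
    norm_num
    ring
  rw [hasDerivAt_pi]
  intro i
  fin_cases i
  · refine (hκd.fun_mul (hasDerivAt_line_apply p v 0 0)).congr_deriv ?_
    simp [hκ]; ring
  · refine (hκd.fun_mul (hasDerivAt_line_apply p v 1 0)).congr_deriv ?_
    simp [hκ]; ring
  · refine ((hκd.add_const b).fun_mul (hasDerivAt_line_apply p v 2 0)).congr_deriv ?_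
    simp [hκ]; ring
  · exact hasDerivAt_const _ _

/-- The radial component of the field depends on `r` alone and its angular component on `θ` alone.
Hence the Lie derivative multiplies `dr` by `(Δ(r - μ))'`, multiplies `sin² θ dφ` by `-2b cos² θ`,
kills `dt`, and sends the round metric `q` to `2b(1 - 2cos² θ) q - 2b (sin² θ dφ)²`. The proof
checks these rates in Cartesian coordinates, then inserts them in the quadratic form. -/
theorem hasDerivAt_kerrMetric_gradField {m a μ b : ℝ} {p v Y : Fin 4 → ℝ}
    (hr : 0 < radius (space p)) (hΔ : kerrDelta m a (space p) ≠ 0)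
    (hX : HasDerivAt (fun h : ℝ => gradField m a μ b (p + h • v)) Y 0) :
    HasDerivAt (fun h : ℝ => (v + h • Y) ⬝ᵥ
        (kerrMetric m a (p + h • gradField m a μ b p) *ᵥ (v + h • Y)))
      (lieForm m a μ b (radius (space p)) (cosTheta (space p)) (formDr (space p) ⬝ᵥ v)
        (formSinSqDphi (space p) ⬝ᵥ v) (v 3) (sphereSq (space p) v)) 0 := by
  set X := gradField m a μ b p with hXdef
  set r := radius (space p) with hrdef
  set c := cosTheta (space p) with hcdef
  set u := formDr (space p) ⬝ᵥ v with hudef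
  set s := formSinSqDphi (space p) ⬝ᵥ v with hsdef
  set q := sphereSq (space p) v with hqdef
  set d := dCosTheta (space p) v with hddef
  set D := r ^ 2 - 2 * m * r + a ^ 2 with hDdef
  set κ := gradFactor m a μ b (space p) with hκ
  obtain ⟨κ', hκ'⟩ : ∃ κ', κ' = (2 * r - 2 * m) * (1 - μ / r) * u
    + D * μ / r ^ 2 * u - 2 * b * c * d := ⟨_, rfl⟩
  have hY := hX.unique (hasDerivAt_gradField hr v hκ hκ')
  have hr2 : r ^ 2 = p 0 ^ 2 + p 1 ^ 2 + p 2 ^ 2 := radius_sq _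
  have hz : p 2 = c * r := (cosTheta_mul_radius hr).symm
  have hu : p 0 * v 0 + p 1 * v 1 + p 2 * v 2 = r * u := by
    rw [hudef, formDr_dotProduct, ← hrdef]
    change _ = r * ((p 0 * v 0 + p 1 * v 1 + p 2 * v 2) / r)
    field_simp
  have hs : p 0 * v 1 - p 1 * v 0 = r ^ 2 * s := by
    rw [hsdef, formSinSqDphi_dotProduct, ← hrdef]
    change _ = r ^ 2 * ((p 0 * v 1 - p 1 * v 0) / r ^ 2)
    field_simp
  have hP : v 0 ^ 2 + v 1 ^ 2 + v 2 ^ 2 - u ^ 2 = r ^ 2 * q := by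
    rw [hqdef, sphereSq, ← hrdef, ← hudef]; field_simp
  have hv2 : v 2 = c * u + r * d := by
    rw [hddef, dCosTheta, ← hrdef, ← hcdef, ← hudef]; field_simp; ring
  have hgeo : d ^ 2 + s ^ 2 = (1 - c ^ 2) * q := dCosTheta_sq_add_sq hr v
  have hκD : r * (κ + b * c ^ 2) = D * (r - μ) := by
    rw [hκ, gradFactor, kerrDelta, ← hrdef, ← hcdef, hDdef]; field_simp; ring
  have hX0 : X 0 = κ * p 0 := rfl
  have hX1 : X 1 = κ * p 1 := rfl
  have hX2 : X 2 = (κ + b) * p 2 := rfl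
  have hY0 : Y 0 = κ * v 0 + κ' * p 0 := by rw [hY]; rfl
  have hY1 : Y 1 = κ * v 1 + κ' * p 1 := by rw [hY]; rfl
  have hY2 : Y 2 = (κ + b) * v 2 + κ' * p 2 := by rw [hY]; rfl
  have hY3 : Y 3 = 0 := by rw [hY]; rfl
  have hp0 : p + (0 : ℝ) • X = p := by simp
  have hv0 : v + (0 : ℝ) • Y = v := by simp
  have hγ : ∀ i, HasDerivAt (fun h : ℝ => space (p + h • X) i) (space X i) 0 :=
    fun i => hasDerivAt_line_apply p X i.castSucc 0
  have hx : space p 0 * space X 0 + space p 1 * space X 1 + space p 2 * space X 2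
      = r * (D * (r - μ)) := by
    change p 0 * X 0 + p 1 * X 1 + p 2 * X 2 = _
    rw [hX0, hX1, hX2, ← hκD]
    linear_combination (-κ) * hr2 + b * (p 2 + c * r) * hz
  have hR : HasDerivAt (fun h : ℝ => radius (space (p + h • X))) (D * (r - μ)) 0 := by
    refine (hasDerivAt_radius hγ (by rw [hp0]; exact hr)).congr_deriv ?_
    rw [hp0, hx, ← hrdef]; field_simp
  have hC : HasDerivAt (fun h : ℝ => cosTheta (space (p + h • X))) (b * c * (1 - c ^ 2)) 0 := by
    refine (hasDerivAt_cosTheta hγ (by rw [hp0]; exact hr)).congr_deriv ?_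
    rw [hp0, hx, ← hrdef, ← hcdef]
    change (X 2 - _) / _ = _
    rw [hX2, hz]
    field_simp
    linear_combination c * hκD
  have hw : ∀ i, HasDerivAt (fun h : ℝ => (v + h • Y) i) (Y i) 0 :=
    fun i => hasDerivAt_line_apply v Y i 0
  have hpp : ∀ i, HasDerivAt (fun h : ℝ => (p + h • X) i) (X i) 0 :=
    fun i => hasDerivAt_line_apply p X i 0
  have hr' : radius (space (p + (0 : ℝ) • X)) ≠ 0 := by rw [hp0]; exact hr.ne'
  have hU : HasDerivAt (fun h : ℝ => formDr (space (p + h • X)) ⬝ᵥ (v + h • Y))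
      (((2 * r - 2 * m) * (r - μ) + D) * u) 0 := by
    simp_rw [formDr_dotProduct]
    refine (((((hpp 0).fun_mul (hw 0)).fun_add ((hpp 1).fun_mul (hw 1))).fun_add
      ((hpp 2).fun_mul (hw 2))).fun_div hR hr').congr_deriv ?_
    rw [hp0, hv0, hu, hX0, hX1, hX2, hY0, hY1, hY2, ← hrdef]
    have e : κ * p 0 * v 0 + p 0 * (κ * v 0 + κ' * p 0) + (κ * p 1 * v 1 + p 1 * (κ * v 1 + κ' * p 1))
        + ((κ + b) * p 2 * v 2 + p 2 * ((κ + b) * v 2 + κ' * p 2))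
        = 2 * κ * (r * u) + 2 * b * (c * r) * (c * u + r * d) + κ' * r ^ 2 := by
      rw [← hu, ← hv2, ← hz, hr2]; ring
    rw [e, hκ']
    field_simp
    linear_combination 2 * u * hκD
  have hS : HasDerivAt (fun h : ℝ => formSinSqDphi (space (p + h • X)) ⬝ᵥ (v + h • Y))
      (-2 * b * c ^ 2 * s) 0 := by
    simp_rw [formSinSqDphi_dotProduct]
    have hr2' : radius (space (p + (0 : ℝ) • X)) ^ 2 ≠ 0 := pow_ne_zero 2 hr'
    refine ((((hpp 0).fun_mul (hw 1)).fun_sub ((hpp 1).fun_mul (hw 0))).fun_div (hR.fun_pow 2)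
      hr2').congr_deriv ?_
    rw [hp0, hv0, hs, hX0, hX1, hY0, hY1, ← hrdef]
    have e : κ * p 0 * v 1 + p 0 * (κ * v 1 + κ' * p 1) - (κ * p 1 * v 0 + p 1 * (κ * v 0 + κ' * p 0))
        = 2 * κ * (r ^ 2 * s) := by rw [← hs]; ring
    rw [e]
    field_simp
    norm_num
    linear_combination 2 * r * s * hκD
  have hPd : HasDerivAt (fun h : ℝ => (v + h • Y) 0 ^ 2 + (v + h • Y) 1 ^ 2 + (v + h • Y) 2 ^ 2)
      (2 * (u * (((2 * r - 2 * m) * (r - μ) + D) * u)) + 2 * (r * (D * (r - μ))) * q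
        + r ^ 2 * (2 * b * (1 - 2 * c ^ 2) * q - 2 * b * s ^ 2)) 0 := by
    refine ((((hw 0).fun_pow 2).fun_add ((hw 1).fun_pow 2)).fun_add
      ((hw 2).fun_pow 2)).congr_deriv ?_
    rw [hv0, hY0, hY1, hY2]
    have e : 2 * v 0 * (κ * v 0 + κ' * p 0) + 2 * v 1 * (κ * v 1 + κ' * p 1)
        + 2 * v 2 * ((κ + b) * v 2 + κ' * p 2)
        = 2 * κ * (u ^ 2 + r ^ 2 * q) + 2 * b * (c * u + r * d) ^ 2 + 2 * κ' * (r * u) := by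
      rw [← hu, ← hP, ← hv2]; ring
    have e' : κ' * r = (2 * r - 2 * m) * (r - μ) * u + D * μ / r * u - 2 * b * c * d * r := by
      rw [hκ']; field_simp
    have e'' : D * μ / r = D - (κ + b * c ^ 2) := by
      field_simp; linear_combination hκD
    norm_num
    linear_combination e + 2 * u * e' + 2 * u ^ 2 * e'' + 2 * b * r ^ 2 * hgeo + 2 * r * q * hκD
  have h3 : ∀ h : ℝ, (v + h • Y) 3 = v 3 := fun h => by simp [hY3]
  have hfin := hasDerivAt_kerrQuadratic (m := m) (a := a) (τ := v 3) (q := q)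
    (q' := 2 * b * (1 - 2 * c ^ 2) * q - 2 * b * s ^ 2) hR hC hU hS hPd
    (by rw [hp0]; exact hr) (by rw [hp0]; exact hΔ) (by rw [hp0, hv0]; exact hP)
    (by rw [hp0, hv0]; ring)
  simp_rw [kerrMetric_quadratic, h3]
  refine hfin.congr_deriv ?_
  rw [hp0, hv0]
  simp only [lieForm, ← hrdef, ← hcdef, ← hudef, ← hsdef, ← hDdef]
  ring

/-- The Hessian of a potential on vectors tangent to its level sets. -/
theorem kerrRhoSq_mul_hessian {m a : ℝ} (hm : 0 < m) (μ b k : ℝ) {p v : Fin 4 → ℝ}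
    (hr : 0 < radius (space p)) (hΔ : 0 < kerrDelta m a (space p))
    (hρ : 2 * m * radius (space p) < kerrRhoSq a (space p))
    (hv : fderiv ℝ (potential μ b k) (space p) (space v) = 0) :
    kerrRhoSq a (space p) *
        hessian (kerrMetric m a) (fun q => potential μ b k (space q)) p v v =
      lieForm m a μ b (radius (space p)) (cosTheta (space p)) (formDr (space p) ⬝ᵥ v)
        (formSinSqDphi (space p) ⬝ᵥ v) (v 3) (sphereSq (space p) v) := by
  have hX := hasDerivAt_gradField (m := m) (a := a) (μ := μ) (b := b) hr v rfl rfl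
  have hQ := hasDerivAt_kerrMetric_gradField hr hΔ.ne' hX
  have hsp : ContDiffAt ℝ 2 space p := contDiff_space.contDiffAt
  have hΦ : ContDiffAt ℝ 2 (fun q => potential μ b k (space q)) p :=
    ContDiffAt.comp (f := space) p (contDiffAt_potential μ b k hr) hsp
  have hsc : Continuous space := (contDiff_space (k := 0)).continuous
  have hev1 : ∀ᶠ q in 𝓝 p, 0 < radius (space q) :=
    (continuous_radius.comp hsc).continuousAt.eventually (lt_mem_nhds hr)
  have hev2 : ∀ᶠ q in 𝓝 p, 0 < kerrDelta m a (space q) := by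
    have : Continuous fun q => kerrDelta m a (space q) := by
      have := continuous_radius.comp hsc
      unfold kerrDelta
      fun_prop
    exact this.continuousAt.eventually (lt_mem_nhds hΔ)
  have hgrad : ∀ᶠ q in 𝓝 p, ∀ j, (kerrMetric m a q *ᵥ gradField m a μ b q) j =
      (kerrRhoSq a (space q) / 2) * pderiv j (fun q => potential μ b k (space q)) q := by
    filter_upwards [hev1, hev2] with q h1 h2 j
    exact kerrMetric_mulVec_gradField m a μ b k h1 h2.ne' j
  have hc : DifferentiableAt ℝ (fun q => kerrRhoSq a (space q) / 2) p := by
    have dr : DifferentiableAt ℝ (fun q : Fin 4 → ℝ => radius (space q)) p :=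
      DifferentiableAt.comp (f := space) p
        ((contDiffAt_radius hr (k := 1)).differentiableAt (by norm_num))
        (hsp.differentiableAt (by norm_num))
    have dc : DifferentiableAt ℝ (fun q : Fin 4 → ℝ => cosTheta (space q)) p :=
      DifferentiableAt.comp (f := space) p
        ((contDiffAt_cosTheta hr (k := 1)).differentiableAt (by norm_num))
        (hsp.differentiableAt (by norm_num))
    unfold kerrRhoSq
    fun_prop
  have hv' : ∑ j, v j * pderiv j (fun q => potential μ b k (space q)) p = 0 := by
    rw [← fderiv_apply_eq_sum_pderiv, fderiv_comp_space
      ((contDiffAt_potential μ b k hr (l := 1)).differentiableAt (by norm_num)), hv]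
  have := mul_hessian_eq_lieDeriv (kerrMetric_symm m a p) (kerrMetric_det_ne_zero hm hr hΔ hρ)
    (differentiableAt_kerrMetric hr hΔ.ne') (differentiableAt_pderiv hΦ) hc hX hgrad hv' hQ
  rw [← this]
  ring

/-! ### The sign of the Lie derivative on lightlike vectors -/

/-- The value of the Kerr metric on a vector with `dr = u`, `sin² θ dφ = s`, `dt = τ` and
`dθ² + sin² θ dφ² = q`. -/
def kerrForm (m a r c u s τ q : ℝ) : ℝ :=
  (r ^ 2 + a ^ 2 * c ^ 2) / (r ^ 2 - 2 * m * r + a ^ 2) * u ^ 2 + (r ^ 2 + a ^ 2 * c ^ 2) * q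
    + a ^ 2 * s ^ 2 - τ ^ 2 + 2 * m * r / (r ^ 2 + a ^ 2 * c ^ 2) * (τ - a * s) ^ 2

/-- With `ρ` standing for `ρ²` and `σ = dt - a sin² θ dφ`, the form is a positive multiple of `2rqρ²
+ 2m(ρ - 2r²)σ²`. Nullity gives `σ² ≤ 4ρq`, so the second term is at least `-8mqρ²`, and the first
wins once `r > 4m`. -/
theorem lieForm_pos_of_large {m a r c s τ q : ℝ} (hm : 0 < m) (ha : a ^ 2 < m ^ 2)
    (hr : 10 * m < r) (hs : s ^ 2 ≤ q) (hq : 0 < q)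
    (h0 : kerrForm m a r c 0 s τ q = 0) : 0 < lieForm m a 0 0 r c 0 s τ q := by
  have hr0 : 0 < r := by linarith
  have hD : 0 < r ^ 2 - 2 * m * r + a ^ 2 := by nlinarith [sq_nonneg a]
  set ρ := r ^ 2 + a ^ 2 * c ^ 2 with hρ
  have hρ0 : 0 < ρ := by positivity
  have hrρ : r ^ 2 ≤ ρ := by rw [hρ]; nlinarith [mul_nonneg (sq_nonneg a) (sq_nonneg c)]
  set σ := τ - a * s with hσ
  -- Together with `a² ≤ ρ/100`, this is what `r > 10m` provides for absorbing the rotational terms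
  -- into `4ρq`.
  have hf : 2 * m * r / ρ ≤ 1 / 5 := by
    rw [div_le_div_iff₀ hρ0 (by norm_num)]; nlinarith
  have e : ρ * q + a ^ 2 * s ^ 2 - τ ^ 2 + 2 * m * r / ρ * σ ^ 2 = 0 := by
    have := h0; simp only [kerrForm, ← hρ, ← hσ] at this; linarith
  have h1 : 2 * m * r / ρ * σ ^ 2 ≤ 1 / 5 * σ ^ 2 := mul_le_mul_of_nonneg_right hf (sq_nonneg _)
  have h2 : σ ^ 2 ≤ 2 * τ ^ 2 + 2 * (a ^ 2 * s ^ 2) := by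
    rw [hσ]; nlinarith [sq_nonneg (τ + a * s)]
  have h3 : a ^ 2 * s ^ 2 ≤ ρ / 100 * q := by
    have : a ^ 2 ≤ ρ / 100 := by nlinarith
    exact mul_le_mul this hs (sq_nonneg _) (by positivity)
  have h4 : σ ^ 2 ≤ 4 * (ρ * q) := by nlinarith [mul_pos hρ0 hq]
  have hL : lieForm m a 0 0 r c 0 s τ q = (r ^ 2 - 2 * m * r + a ^ 2) * r / ρ ^ 2 *
      (2 * r * q * ρ ^ 2 + 2 * m * (ρ - 2 * r ^ 2) * σ ^ 2) := by
    simp only [lieForm, ← hρ, hσ]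
    field_simp
    ring
  rw [hL]
  refine mul_pos (by positivity) ?_
  have h5 : 2 * m * (2 * r ^ 2 - ρ) * σ ^ 2 ≤ 2 * m * ρ * (4 * (ρ * q)) := by
    calc 2 * m * (2 * r ^ 2 - ρ) * σ ^ 2 ≤ 2 * m * ρ * σ ^ 2 := by
          refine mul_le_mul_of_nonneg_right ?_ (sq_nonneg _)
          exact mul_le_mul_of_nonneg_left (by linarith) (by positivity)
      _ ≤ _ := mul_le_mul_of_nonneg_left h4 (by positivity)
  nlinarith [mul_pos (mul_pos hq (pow_pos hρ0 2)) (sub_pos.2 hr),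
    mul_pos hm (mul_pos hq (pow_pos hρ0 2))]

/-- Nullity reads `r³ q = (r - 2m) τ²`; substituted into the form it leaves a positive factor times
`2(r - 3m) τ²`. The photon sphere `r = 3m` is the threshold. -/
theorem lieForm_neg_of_schwarzschild {m ε r c s τ q : ℝ} (hm : 0 < m) (hε : 0 < ε)
    (hr : m < r) (hr3 : r < 3 * m) (hψ : r ^ 2 - 2 * m * r = ε) (hN : 0 < q + τ ^ 2)
    (h0 : kerrForm m 0 r c 0 s τ q = 0) : lieForm m 0 m 0 r c 0 s τ q < 0 := by
  have hr0 : 0 < r := by linarith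
  have e : r ^ 3 * q = τ ^ 2 * (r - 2 * m) := by
    have h : r * kerrForm m 0 r c 0 s τ q = r ^ 3 * q - τ ^ 2 * (r - 2 * m) := by
      simp only [kerrForm]; field_simp; ring
    rw [h0] at h; linarith
  have hτ : 0 < τ ^ 2 := by
    rcases (sq_nonneg τ).lt_or_eq with h | h
    · exact h
    · rw [← h] at e hN
      have : 0 < r ^ 3 * q := mul_pos (by positivity) (by linarith)
      rw [zero_mul] at e
      linarith
  have hL : lieForm m 0 m 0 r c 0 s τ q
      = (r ^ 2 - 2 * m * r) * (r - m) / r ^ 2 * (2 * (r ^ 3 * q) - 2 * m * τ ^ 2) := by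
    simp only [lieForm]
    field_simp
    ring
  rw [hL, hψ, e]
  refine mul_neg_of_pos_of_neg (div_pos (mul_pos hε (by linarith)) (by positivity)) ?_
  nlinarith

theorem lieForm_smul (m a μ b r c u s τ q k : ℝ) :
    lieForm m a μ b r c (k * u) (k * s) (k * τ) (k ^ 2 * q)
      = k ^ 2 * lieForm m a μ b r c u s τ q := by
  simp only [lieForm]
  ring

theorem kerrForm_smul (m a r c u s τ q k : ℝ) :
    kerrForm m a r c (k * u) (k * s) (k * τ) (k ^ 2 * q) = k ^ 2 * kerrForm m a r c u s τ q := by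
  simp only [kerrForm]
  ring

/-- The parameters `(a, r, cos θ, d cos θ, sin² θ dφ, dt, dθ² + sin² θ dφ²)` of a normalised
vector tangent to the hypersurface `ρ² - 2 m r = ε`. -/
def tangentParams (m ε : ℝ) : Set (Fin 7 → ℝ) :=
  Set.pi Set.univ (fun i => Set.Icc (![-m, m, -1, -1, -1, -1, 0] i) (![m, 3 * m, 1, 1, 1, 1, 1] i))
    ∩ {y | y 1 ^ 2 - 2 * m * y 1 + y 0 ^ 2 * y 2 ^ 2 = ε ∧ y 6 + y 5 ^ 2 = 1}

theorem isCompact_tangentParams (m ε : ℝ) : IsCompact (tangentParams m ε) := by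
  refine (isCompact_univ_pi fun i => isCompact_Icc).inter_right ?_
  exact (isClosed_eq (by fun_prop) (by fun_prop)).inter (isClosed_eq (by fun_prop) (by fun_prop))

theorem tangentParams_pos {m ε : ℝ} (hm : 0 < m) (hε : 0 < ε) {y : Fin 7 → ℝ}
    (hy : y ∈ tangentParams m ε) :
    0 < y 1 - m ∧ 0 < y 1 ^ 2 + y 0 ^ 2 * y 2 ^ 2 ∧ 0 < y 1 ^ 2 - 2 * m * y 1 + y 0 ^ 2 := by
  obtain ⟨hB, hψ, -⟩ := hy
  have h0 : -m ≤ y 0 ∧ y 0 ≤ m := hB 0 trivial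
  have h1 : m ≤ y 1 ∧ y 1 ≤ 3 * m := hB 1 trivial
  have h2 : -1 ≤ y 2 ∧ y 2 ≤ 1 := hB 2 trivial
  have ha : y 0 ^ 2 ≤ m ^ 2 := sq_le_sq' h0.1 h0.2
  have hc : y 2 ^ 2 ≤ 1 := by nlinarith
  have hac : y 0 ^ 2 * y 2 ^ 2 ≤ y 0 ^ 2 := mul_le_of_le_one_right (sq_nonneg _) hc
  have hy1 : 0 < y 1 := by linarith
  refine ⟨?_, by positivity, by linarith⟩
  rcases h1.1.lt_or_eq with h | h
  · linarith
  · rw [← h] at hψ; nlinarith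

/-- Inner boundary: near the Schwarzschild metric, the Lie derivative is negative on lightlike
vectors tangent to `ρ² - 2 m r = ε`. -/
theorem exists_forall_lieForm_neg {m ε : ℝ} (hm : 0 < m) (hε : 0 < ε) (hε3 : ε < 3 * m ^ 2) :
    ∃ a₀ : ℝ, 0 < a₀ ∧ ∀ a r c d u s τ q : ℝ, |a| < a₀ → m < r →
      r ^ 2 - 2 * m * r + a ^ 2 * c ^ 2 = ε → c ^ 2 ≤ 1 → d ^ 2 ≤ q → s ^ 2 ≤ q → 0 < q + τ ^ 2 →
      (r - m) * u + a ^ 2 * c * d = 0 → kerrForm m a r c u s τ q = 0 →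
      lieForm m a m (a ^ 2) r c u s τ q < 0 := by
  -- Tangency `(r - m) dr + a² cos θ d(cos θ) = 0` determines `dr`, so it needs no coordinate of its
  -- own. The division is continuous because `r > m` on the parameter set.
  let U : (Fin 7 → ℝ) → ℝ := fun y => -(y 0 ^ 2 * y 2 * y 3) / (y 1 - m)
  let G : (Fin 7 → ℝ) → ℝ := fun y => kerrForm m (y 0) (y 1) (y 2) (U y) (y 4) (y 5) (y 6)
  let L : (Fin 7 → ℝ) → ℝ :=
    fun y => lieForm m (y 0) m (y 0 ^ 2) (y 1) (y 2) (U y) (y 4) (y 5) (y 6)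
  have hK := isCompact_tangentParams m ε
  have n1 : ∀ y ∈ tangentParams m ε, y 1 - m ≠ 0 :=
    fun y hy => (tangentParams_pos hm hε hy).1.ne'
  have n2 : ∀ y ∈ tangentParams m ε, y 1 ^ 2 + y 0 ^ 2 * y 2 ^ 2 ≠ 0 :=
    fun y hy => (tangentParams_pos hm hε hy).2.1.ne'
  have n3 : ∀ y ∈ tangentParams m ε, y 1 ^ 2 - 2 * m * y 1 + y 0 ^ 2 ≠ 0 :=
    fun y hy => (tangentParams_pos hm hε hy).2.2.ne'
  have n4 : ∀ y ∈ tangentParams m ε, (y 1 ^ 2 + y 0 ^ 2 * y 2 ^ 2) ^ 2 ≠ 0 :=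
    fun y hy => pow_ne_zero 2 (n2 y hy)
  have n5 : ∀ y ∈ tangentParams m ε, (y 1 ^ 2 - 2 * m * y 1 + y 0 ^ 2) ^ 2 ≠ 0 :=
    fun y hy => pow_ne_zero 2 (n3 y hy)
  have cU : ContinuousOn U (tangentParams m ε) := by
    fun_prop (disch := assumption)
  have cG : ContinuousOn G (tangentParams m ε) := by
    simp only [G, kerrForm]
    fun_prop (disch := assumption)
  have cL : ContinuousOn L (tangentParams m ε) := by
    simp only [L, lieForm]
    fun_prop (disch := assumption)
  -- The parameters of null tangent directions with the wrong sign. This compact set misses `a = 0`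
  -- by the Schwarzschild case, so `|a|` has a positive minimum on it, which serves as the
  -- threshold; if the set is empty, any threshold does.
  have hbad : IsCompact {y | y ∈ tangentParams m ε ∧ G y = 0 ∧ 0 ≤ L y} := by
    have k1 := cG.preimage_isClosed_of_isClosed hK.isClosed (isClosed_singleton (x := (0 : ℝ)))
    have k2 := cL.preimage_isClosed_of_isClosed hK.isClosed (isClosed_Ici (a := (0 : ℝ)))
    refine hK.of_isClosed_subset ?_ (fun y hy => hy.1)
    convert k1.inter k2 using 1
    ext y
    simp only [Set.mem_ofPred_eq, Set.mem_inter_iff, Set.mem_preimage, Set.mem_singleton_iff,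
      Set.mem_Ici]
    tauto
  have hscw : ∀ y ∈ tangentParams m ε, G y = 0 → y 0 = 0 → L y < 0 := by
    intro y hy hG h0
    have hpos := (tangentParams_pos hm hε hy).1
    obtain ⟨hB, hψ, hN⟩ := hy
    have h1 : m ≤ y 1 ∧ y 1 ≤ 3 * m := hB 1 trivial
    have hU : U y = 0 := by simp [U, h0]
    simp only [G, L, hU, h0] at hG ⊢
    rw [h0] at hψ
    rw [show (0 : ℝ) ^ 2 = 0 by norm_num]
    refine lieForm_neg_of_schwarzschild hm hε (by linarith) ?_ (by linarith) (by linarith) hG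
    rcases h1.2.lt_or_eq with h | h
    · exact h
    · rw [h] at hψ; nlinarith
  have hmin : ∃ a₀ : ℝ, 0 < a₀ ∧ ∀ y ∈ tangentParams m ε, |y 0| < a₀ → G y = 0 → L y < 0 := by
    rcases Set.eq_empty_or_nonempty {y | y ∈ tangentParams m ε ∧ G y = 0 ∧ 0 ≤ L y} with he | hne
    · refine ⟨1, one_pos, fun y hy _ hG => ?_⟩
      by_contra hL
      have : y ∈ {y | y ∈ tangentParams m ε ∧ G y = 0 ∧ 0 ≤ L y} := ⟨hy, hG, not_lt.1 hL⟩
      rw [he] at this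
      exact this
    · obtain ⟨z, ⟨hz, hzG, hzL⟩, hzmin⟩ := hbad.exists_isMinOn hne
        (f := fun y => |y 0|) (by fun_prop)
      refine ⟨|z 0|, abs_pos.2 fun h => ?_, fun y hy ha hG => ?_⟩
      · exact absurd (hscw z hz hzG h) (not_lt.2 hzL)
      · by_contra hL
        exact absurd ha (not_lt.2 (hzmin ⟨hy, hG, not_lt.1 hL⟩))
  obtain ⟨a₀, ha₀, H⟩ := hmin
  -- The cut at `m` keeps `a` in the parameter box. A general vector is then divided by `√(q + τ²)`:
  -- both forms are homogeneous of degree two, with `q` itself quadratic in the vector.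
  refine ⟨min a₀ m, lt_min ha₀ hm, fun a r c d u s τ q ha hr hψ hc hd hs hN hu hG => ?_⟩
  obtain ⟨ha1, ha2⟩ := lt_min_iff.1 ha
  obtain ⟨ha3, ha4⟩ := abs_lt.1 ha2
  set k := √(q + τ ^ 2) with hk
  have hk0 : 0 < k := Real.sqrt_pos.2 hN
  have hk2 : k ^ 2 = q + τ ^ 2 := Real.sq_sqrt hN.le
  have hq0 : 0 ≤ q := (sq_nonneg d).trans hd
  have hbound : ∀ w : ℝ, w ^ 2 ≤ k ^ 2 → -1 ≤ w / k ∧ w / k ≤ 1 := by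
    intro w hw
    rw [← abs_le, abs_div, abs_of_pos hk0]
    exact div_le_one_of_le₀ (abs_le_of_sq_le_sq hw hk0.le) hk0.le
  have hr3 : r ≤ 3 * m := by
    have : 0 ≤ a ^ 2 * c ^ 2 := by positivity
    nlinarith
  have hrm : r - m ≠ 0 := by linarith
  let y : Fin 7 → ℝ := ![a, r, c, d / k, s / k, τ / k, q / k ^ 2]
  have hy : y ∈ tangentParams m ε := by
    refine ⟨fun i _ => ?_, hψ, ?_⟩
    · fin_cases i
      · exact ⟨ha3.le, ha4.le⟩
      · exact ⟨hr.le, hr3⟩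
      · exact abs_le.1 ((sq_le_one_iff_abs_le_one c).1 hc)
      · exact hbound d (by nlinarith [sq_nonneg τ])
      · exact hbound s (by nlinarith [sq_nonneg τ])
      · exact hbound τ (by linarith)
      · exact ⟨div_nonneg hq0 (sq_nonneg k),
          div_le_one_of_le₀ (by nlinarith [sq_nonneg τ]) (sq_nonneg k)⟩
    · change q / k ^ 2 + (τ / k) ^ 2 = 1
      field_simp
      linarith
  have hUy : k * U y = u := by
    change k * (-(a ^ 2 * c * (d / k)) / (r - m)) = u
    field_simp
    linarith
  have es : k * (s / k) = s := by field_simp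
  have eτ : k * (τ / k) = τ := by field_simp
  have eq : k ^ 2 * (q / k ^ 2) = q := by field_simp
  have hGy : G y = 0 := by
    have h : kerrForm m a r c (k * U y) (k * (s / k)) (k * (τ / k)) (k ^ 2 * (q / k ^ 2))
        = k ^ 2 * G y := kerrForm_smul _ _ _ _ _ _ _ _ _
    rw [hUy, es, eτ, eq, hG] at h
    exact (mul_eq_zero.1 h.symm).resolve_left (by positivity)
  have hLy := H y hy ha1 hGy
  have h : lieForm m a m (a ^ 2) r c (k * U y) (k * (s / k)) (k * (τ / k)) (k ^ 2 * (q / k ^ 2))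
      = k ^ 2 * L y := lieForm_smul _ _ _ _ _ _ _ _ _ _ _
  rw [hUy, es, eτ, eq] at h
  rw [h]
  exact mul_neg_of_pos_of_neg (by positivity) hLy

/-! ### The topology of the shells -/

/-- Replaces the square roots by sign conditions on a smooth potential. The radicand is positive
because `a² < m²`, which forces `r > m` and selects the larger root. -/
theorem add_sqrt_lt_iff {m a ε r c : ℝ} (ha : a ^ 2 < m ^ 2) (hε : 0 ≤ ε) (hc : c ^ 2 ≤ 1) :
    m + √(m ^ 2 + ε - a ^ 2 * c ^ 2) < r ↔ m < r ∧ 0 < r ^ 2 - 2 * m * r + a ^ 2 * c ^ 2 - ε := by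
  have h : a ^ 2 * c ^ 2 ≤ a ^ 2 := mul_le_of_le_one_right (sq_nonneg _) hc
  have hY : 0 < √(m ^ 2 + ε - a ^ 2 * c ^ 2) := Real.sqrt_pos.2 (by linarith)
  rw [← lt_sub_iff_add_lt']
  constructor
  · intro h1
    have h2 := (Real.sqrt_lt' (hY.trans h1)).1 h1
    exact ⟨by linarith, by nlinarith⟩
  · rintro ⟨h1, h2⟩
    exact (Real.sqrt_lt' (sub_pos.2 h1)).2 (by nlinarith)

theorem mem_kerrRegion_iff {m a : ℝ} (ha : a ^ 2 < m ^ 2) {x : Fin 3 → ℝ} :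
    x ∈ kerrRegion m a ↔ m < radius x ∧ 0 < potential m (a ^ 2) 0 x := by
  have := add_sqrt_lt_iff (r := radius x) ha le_rfl (cosTheta_sq_le_one x)
  rw [add_zero] at this
  exact this

theorem mem_kerrShell_iff {m a ε : ℝ} {r₀ : EReal} (ha : a ^ 2 < m ^ 2) (hε : 0 ≤ ε)
    {x : Fin 3 → ℝ} : x ∈ kerrShell m a ε r₀ ↔
      m < radius x ∧ 0 < potential m (a ^ 2) ε x ∧ (radius x : EReal) < r₀ := by
  rw [← and_assoc]
  exact and_congr_left' (add_sqrt_lt_iff ha hε (cosTheta_sq_le_one x))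

theorem radius_smul {t : ℝ} (ht : 0 ≤ t) (x : Fin 3 → ℝ) : radius (t • x) = t * radius x := by
  rw [radius, radius, ← Real.sqrt_sq ht, ← Real.sqrt_mul (sq_nonneg t), Real.sqrt_sq ht]
  congr 1
  simp only [Pi.smul_apply, smul_eq_mul]
  ring

theorem cosTheta_smul {t : ℝ} (ht : 0 < t) (x : Fin 3 → ℝ) : cosTheta (t • x) = cosTheta x := by
  rw [cosTheta, cosTheta, radius_smul ht.le, Pi.smul_apply, smul_eq_mul]
  exact mul_div_mul_left _ _ ht.ne'

/-- Since `cos θ` is constant on rays, only `r² - 2μr` changes. For `r > μ > 0` and `t > 1` the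
increment is positive, so points of the inner boundary are limits from the interior. -/
theorem potential_smul {t : ℝ} (ht : 0 < t) (μ b k : ℝ) (x : Fin 3 → ℝ) :
    potential μ b k (t • x)
      = potential μ b k x + (t - 1) * radius x * ((t + 1) * radius x - 2 * μ) := by
  simp only [potential, radius_smul ht.le, cosTheta_smul ht]
  ring

theorem continuous_coe_radius : Continuous fun x : Fin 3 → ℝ => (radius x : EReal) :=
  continuous_coe_real_ereal.comp continuous_radius

theorem continuousOn_potential (μ b k : ℝ) : ContinuousOn (potential μ b k) {x | 0 < radius x} :=
  fun _ hx => (contDiffAt_potential μ b k hx (l := 0)).continuousAt.continuousWithinAt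

theorem isOpen_kerrShell {m a ε : ℝ} (r₀ : EReal) (hm : 0 < m) (ha : a ^ 2 < m ^ 2) (hε : 0 ≤ ε) :
    IsOpen (kerrShell m a ε r₀) := by
  have h1 : IsOpen {x : Fin 3 → ℝ | m < radius x} := isOpen_lt continuous_const continuous_radius
  have h2 := ((continuousOn_potential m (a ^ 2) ε).mono
    fun x (hx : m < radius x) => hm.trans hx).isOpen_inter_preimage h1 (isOpen_Ioi (a := (0 : ℝ)))
  have h3 : IsOpen {x : Fin 3 → ℝ | (radius x : EReal) < r₀} :=
    isOpen_lt continuous_coe_radius continuous_const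
  convert h2.inter h3 using 1
  ext x
  rw [mem_kerrShell_iff ha hε, ← and_assoc]
  rfl

theorem closure_kerrShell_subset {m a ε : ℝ} (r₀ : EReal) (hm : 0 < m) (ha : a ^ 2 < m ^ 2)
    (hε : 0 ≤ ε) : closure (kerrShell m a ε r₀) ⊆
      {x | m ≤ radius x ∧ 0 ≤ potential m (a ^ 2) ε x ∧ (radius x : EReal) ≤ r₀} := by
  refine closure_minimal (fun x hx => ?_) ?_
  · obtain ⟨h1, h2, h3⟩ := (mem_kerrShell_iff ha hε).1 hx
    exact ⟨h1.le, h2.le, h3.le⟩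
  · have h1 : IsClosed {x : Fin 3 → ℝ | m ≤ radius x} := isClosed_le continuous_const continuous_radius
    have h2 := ((continuousOn_potential m (a ^ 2) ε).mono
      fun x (hx : m ≤ radius x) => hm.trans_le hx).preimage_isClosed_of_isClosed h1
        (isClosed_Ici (a := (0 : ℝ)))
    have h3 : IsClosed {x : Fin 3 → ℝ | (radius x : EReal) ≤ r₀} :=
      isClosed_le continuous_coe_radius continuous_const
    convert h2.inter h3 using 1
    ext x
    exact and_assoc.symm

/-- At `r = m` the potential is `-m² + a² cos² θ - ε < 0`, so the weak bound obtained on a closure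
improves to a strict one. -/
theorem lt_radius_of_potential_nonneg {m a ε : ℝ} (ha : a ^ 2 < m ^ 2) (hε : 0 ≤ ε)
    {x : Fin 3 → ℝ} (h1 : m ≤ radius x) (h2 : 0 ≤ potential m (a ^ 2) ε x) : m < radius x := by
  refine h1.lt_of_ne fun h => ?_
  have hc : a ^ 2 * cosTheta x ^ 2 ≤ a ^ 2 :=
    mul_le_of_le_one_right (sq_nonneg _) (cosTheta_sq_le_one x)
  rw [potential, ← h] at h2
  nlinarith

theorem closure_kerrShell_subset_kerrRegion {m a ε : ℝ} (r₀ : EReal) (hm : 0 < m)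
    (ha : a ^ 2 < m ^ 2) (hε : 0 < ε) : closure (kerrShell m a ε r₀) ⊆ kerrRegion m a := by
  intro x hx
  obtain ⟨h1, h2, -⟩ := closure_kerrShell_subset r₀ hm ha hε.le hx
  rw [mem_kerrRegion_iff ha]
  refine ⟨lt_radius_of_potential_nonneg ha hε.le h1 h2, ?_⟩
  simp only [potential] at h2 ⊢
  linarith

theorem tendsto_smul_one (x : Fin 3 → ℝ) : Tendsto (fun t : ℝ => t • x) (𝓝 1) (𝓝 x) := by
  have : Continuous fun t : ℝ => t • x := by fun_prop
  simpa using this.tendsto 1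

theorem mem_frontier_kerrShell_iff {m a ε : ℝ} {r₀ : EReal} (hm : 0 < m) (ha : a ^ 2 < m ^ 2)
    (hε : 0 < ε) (hε3 : ε < 3 * m ^ 2) (hr₀ : ((3 * m : ℝ) : EReal) < r₀) {x : Fin 3 → ℝ} :
    x ∈ frontier (kerrShell m a ε r₀) ↔
      m < radius x ∧ (potential m (a ^ 2) ε x = 0 ∨ (radius x : EReal) = r₀) := by
  rw [(isOpen_kerrShell r₀ hm ha hε.le).frontier_eq, Set.mem_sdiff, mem_kerrShell_iff ha hε.le]
  constructor
  · rintro ⟨hx, hn⟩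
    obtain ⟨h1, h2, h3⟩ := closure_kerrShell_subset r₀ hm ha hε.le hx
    have h1' := lt_radius_of_potential_nonneg ha hε.le h1 h2
    refine ⟨h1', ?_⟩
    by_contra! hc
    exact hn ⟨h1', lt_of_le_of_ne h2 (Ne.symm hc.1), lt_of_le_of_ne h3 hc.2⟩
  · rintro ⟨h1, h⟩
    have hx0 : 0 < radius x := hm.trans h1
    have hac : 0 ≤ a ^ 2 * cosTheta x ^ 2 := by positivity
    rcases h with h | h
    · refine ⟨?_, fun hc => by rw [h] at hc; exact lt_irrefl _ hc.2.1⟩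
      -- On `ψ = 0` one has `r² - 2mr ≤ ε < 3m²`, so the two boundary pieces are disjoint. An inner
      -- point is approached by dilation, an outer one by contraction.
      have h3 : radius x < 3 * m := by
        rw [potential] at h
        nlinarith
      have hlt : (radius x : EReal) < r₀ := (EReal.coe_lt_coe_iff.2 h3).trans hr₀
      have hev : ∀ᶠ t in 𝓝[>] (1 : ℝ), (radius (t • x) : EReal) < r₀ :=
        ((continuous_coe_radius.tendsto x).comp (tendsto_smul_one x)).mono_left
          nhdsWithin_le_nhds |>.eventually (gt_mem_nhds hlt)
      refine mem_closure_of_tendsto ((tendsto_smul_one x).mono_left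
        (nhdsWithin_le_nhds (s := Set.Ioi 1))) ?_
      filter_upwards [hev, self_mem_nhdsWithin] with t ht ht1
      have ht1' : 1 < t := ht1
      have ht0 : 0 < t := one_pos.trans ht1'
      refine (mem_kerrShell_iff ha hε.le).2 ⟨?_, ?_, ht⟩
      · rw [radius_smul ht0.le]; nlinarith
      · rw [potential_smul ht0, h, zero_add]
        refine mul_pos (mul_pos (sub_pos.2 ht1') hx0) ?_
        nlinarith
    · refine ⟨?_, fun hc => by rw [h] at hc; exact lt_irrefl _ hc.2.2⟩
      have h3 : 3 * m < radius x := by rw [← h] at hr₀; exact EReal.coe_lt_coe_iff.1 hr₀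
      have hev1 : ∀ᶠ t in 𝓝[<] (1 : ℝ), m < radius (t • x) :=
        ((continuous_radius.tendsto x).comp (tendsto_smul_one x)).mono_left
          nhdsWithin_le_nhds |>.eventually (lt_mem_nhds h1)
      have hpos : 0 < potential m (a ^ 2) ε x := by
        rw [potential]; nlinarith
      have hev2 : ∀ᶠ t in 𝓝[<] (1 : ℝ), 0 < potential m (a ^ 2) ε (t • x) :=
        (((contDiffAt_potential m (a ^ 2) ε hx0 (l := 0)).continuousAt.tendsto).comp
          (tendsto_smul_one x)).mono_left nhdsWithin_le_nhds |>.eventually (lt_mem_nhds hpos)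
      refine mem_closure_of_tendsto ((tendsto_smul_one x).mono_left
        (nhdsWithin_le_nhds (s := Set.Iio 1))) ?_
      have hev3 : ∀ᶠ t in 𝓝[<] (1 : ℝ), 0 < t := nhdsWithin_le_nhds (lt_mem_nhds one_pos)
      filter_upwards [hev1, hev2, hev3, self_mem_nhdsWithin] with t t1 t2 t3 t4
      refine (mem_kerrShell_iff ha hε.le).2 ⟨t1, t2, ?_⟩
      rw [← h, radius_smul t3.le, EReal.coe_lt_coe_iff]
      have : t < 1 := t4
      nlinarith

/-- The norm on `Fin 3 → ℝ` is the sup norm, so connectedness of the round sphere is carried over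
from `EuclideanSpace`. -/
theorem isPreconnected_radius_eq {R : ℝ} : IsPreconnected {x : Fin 3 → ℝ | radius x = R} := by
  have hrank : 1 < Module.rank ℝ (EuclideanSpace ℝ (Fin 3)) := by
    rw [← Module.finrank_eq_rank, finrank_euclideanSpace_fin]
    norm_num
  have h := (isPreconnected_sphere hrank (0 : EuclideanSpace ℝ (Fin 3)) R).image
    (fun w => WithLp.ofLp w) (PiLp.continuous_ofLp 2 _).continuousOn
  have hn : ∀ w : EuclideanSpace ℝ (Fin 3), ‖w‖ = radius (WithLp.ofLp w) := fun w => by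
    rw [EuclideanSpace.norm_eq, radius, Fin.sum_univ_three]
    simp
  convert h using 1
  ext x
  constructor
  · intro hx
    exact ⟨WithLp.toLp 2 x, by rw [mem_sphere_zero_iff_norm, hn]; exact hx, rfl⟩
  · rintro ⟨w, hw, rfl⟩
    rw [mem_sphere_zero_iff_norm, hn] at hw
    exact hw

/-- The sphere `r = 3m` lies in the shell because `ε < 3m² < r² - 2mr + a² cos² θ + ε` there, and
each point joins it along its ray. The bounds on `r` are constant on a ray, so the segment stays
inside. -/
theorem isConnected_kerrShell {m a ε : ℝ} {r₀ : EReal} (hm : 0 < m) (ha : a ^ 2 < m ^ 2)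
    (hε : 0 < ε) (hε3 : ε < 3 * m ^ 2) (hr₀ : ((3 * m : ℝ) : EReal) < r₀) :
    IsConnected (kerrShell m a ε r₀) := by
  have hlow : ∀ x : Fin 3 → ℝ, m + √(m ^ 2 + ε - a ^ 2 * cosTheta x ^ 2) < 3 * m := by
    intro x
    rw [add_sqrt_lt_iff ha hε.le (cosTheta_sq_le_one x)]
    have : 0 ≤ a ^ 2 * cosTheta x ^ 2 := by positivity
    exact ⟨by linarith, by nlinarith⟩
  have hsph : {x : Fin 3 → ℝ | radius x = 3 * m} ⊆ kerrShell m a ε r₀ := by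
    intro x hx
    have hx' : radius x = 3 * m := hx
    refine ⟨by rw [hx']; exact hlow x, by rw [hx']; exact hr₀⟩
  have hx₀ : radius ![0, 0, 3 * m] = 3 * m := by
    simp only [radius, Matrix.cons_val]
    rw [show (0 : ℝ) ^ 2 + 0 ^ 2 + (3 * m) ^ 2 = (3 * m) ^ 2 by ring]
    exact Real.sqrt_sq (by linarith)
  refine ⟨⟨_, hsph hx₀⟩, isPreconnected_of_forall ![0, 0, 3 * m] fun y hy => ?_⟩
  have hy0 : 0 < radius y := hm.trans ((mem_kerrShell_iff ha hε.le).1 hy).1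
  set t := 3 * m / radius y with ht
  have ht0 : 0 < t := by positivity
  have htr : t * radius y = 3 * m := by rw [ht]; field_simp
  have hrad : radius (t • y) = 3 * m := by rw [radius_smul ht0.le, htr]
  have hray : IsPreconnected ((fun s : ℝ => s • y) '' Set.uIcc 1 t) :=
    isPreconnected_uIcc.image _ (by fun_prop)
  refine ⟨{x | radius x = 3 * m} ∪ (fun s : ℝ => s • y) '' Set.uIcc 1 t, ?_, Or.inl hx₀,
    Or.inr ⟨1, Set.left_mem_uIcc, one_smul _ _⟩,
    isPreconnected_radius_eq.union (t • y) hrad ⟨t, Set.right_mem_uIcc, rfl⟩ hray⟩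
  refine Set.union_subset hsph ?_
  rintro _ ⟨s, hs, rfl⟩
  obtain ⟨hs1, hs2⟩ := hs
  have hs0 : 0 < s := (lt_min one_pos ht0).trans_le hs1
  change m + √(m ^ 2 + ε - a ^ 2 * cosTheta (s • y) ^ 2) < radius (s • y)
    ∧ (radius (s • y) : EReal) < r₀
  rw [cosTheta_smul hs0, radius_smul hs0.le]
  constructor
  · have h : min (radius y) (3 * m) ≤ s * radius y := by
      rw [← htr]
      rcases min_le_iff.1 hs1 with h | h
      · exact (min_le_left _ _).trans (by nlinarith)
      · exact (min_le_right _ _).trans (mul_le_mul_of_nonneg_right h hy0.le)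
    exact (lt_min hy.1 (hlow y)).trans_le h
  · have h : s * radius y ≤ max (radius y) (3 * m) := by
      rw [← htr]
      rcases le_max_iff.1 hs2 with h | h
      · exact le_max_of_le_left (by nlinarith)
      · exact le_max_of_le_right (mul_le_mul_of_nonneg_right h hy0.le)
    refine (EReal.coe_le_coe_iff.2 h).trans_lt ?_
    rcases max_choice (radius y) (3 * m) with e | e <;> rw [e]
    · exact hy.2
    · exact hr₀

/-! ### Light-convexity of the shells -/

theorem pos_of_mem_kerrRegion {m a : ℝ} (hm : 0 < m) (ha : a ^ 2 < m ^ 2) {x : Fin 3 → ℝ}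
    (hx : x ∈ kerrRegion m a) :
    0 < radius x ∧ 0 < kerrDelta m a x ∧ 2 * m * radius x < kerrRhoSq a x := by
  obtain ⟨h1, h2⟩ := (mem_kerrRegion_iff ha).1 hx
  have hc : a ^ 2 * cosTheta x ^ 2 ≤ a ^ 2 :=
    mul_le_of_le_one_right (sq_nonneg _) (cosTheta_sq_le_one x)
  rw [potential] at h2
  refine ⟨hm.trans h1, ?_, ?_⟩
  · rw [kerrDelta]; linarith
  · rw [kerrRhoSq]; linarith

theorem formSinSqDphi_dotProduct_sq_le {x : Fin 3 → ℝ} (hx : 0 < radius x) (v : Fin 4 → ℝ) :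
    (formSinSqDphi x ⬝ᵥ v) ^ 2 ≤ sphereSq x v := by
  have h := dCosTheta_sq_add_sq hx v
  have h1 := mul_nonneg (sq_nonneg (cosTheta x)) (sphereSq_nonneg hx v)
  nlinarith [sq_nonneg (dCosTheta x v)]

theorem dCosTheta_sq_le {x : Fin 3 → ℝ} (hx : 0 < radius x) (v : Fin 4 → ℝ) :
    dCosTheta x v ^ 2 ≤ sphereSq x v := by
  have h := dCosTheta_sq_add_sq hx v
  have h1 := mul_nonneg (sq_nonneg (cosTheta x)) (sphereSq_nonneg hx v)
  nlinarith [sq_nonneg (formSinSqDphi x ⬝ᵥ v)]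

theorem IsLightlike.kerrForm_eq_zero {m a : ℝ} {p v : Fin 4 → ℝ} (hr : 0 < radius (space p))
    (hv : IsLightlike (kerrMetric m a) p v) :
    kerrForm m a (radius (space p)) (cosTheta (space p)) (formDr (space p) ⬝ᵥ v)
      (formSinSqDphi (space p) ⬝ᵥ v) (v 3) (sphereSq (space p) v) = 0 :=
  (kerrMetric_quadratic_eq hr).symm.trans hv.2

/-- This is the quantity used to normalise lightlike vectors. If it vanished, `sin² θ dφ` would
vanish too, nullity would give `dr = 0`, and the vector would be zero. -/
theorem sphereSq_add_sq_pos {m a : ℝ} (hm : 0 < m) (ha : a ^ 2 < m ^ 2) {p v : Fin 4 → ℝ}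
    (hp : space p ∈ kerrRegion m a) (hv : IsLightlike (kerrMetric m a) p v) :
    0 < sphereSq (space p) v + v 3 ^ 2 := by
  obtain ⟨hr, hΔ, -⟩ := pos_of_mem_kerrRegion hm ha hp
  have hρ := kerrRhoSq_pos a hr
  have hq := sphereSq_nonneg hr v
  refine (add_nonneg hq (sq_nonneg _)).lt_of_ne fun h => hv.1 ?_
  have hq0 : sphereSq (space p) v = 0 := by nlinarith [sq_nonneg (v 3)]
  have hτ : v 3 = 0 := by
    rw [hq0, zero_add] at h
    exact pow_eq_zero_iff two_ne_zero |>.1 h.symm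
  have hs : formSinSqDphi (space p) ⬝ᵥ v = 0 := by
    have := formSinSqDphi_dotProduct_sq_le hr v
    rw [hq0] at this
    exact pow_eq_zero_iff two_ne_zero |>.1 (le_antisymm this (sq_nonneg _))
  have hu : (formDr (space p) ⬝ᵥ v) ^ 2 = 0 := by
    have := hv.2
    rw [kerrMetric_quadratic_eq hr, hq0, hτ, hs] at this
    have h' : kerrRhoSq a (space p) / kerrDelta m a (space p) * (formDr (space p) ⬝ᵥ v) ^ 2 = 0 := by
      linarith
    exact (mul_eq_zero.1 h').resolve_left (by positivity)
  have hP : v 0 ^ 2 + v 1 ^ 2 + v 2 ^ 2 = 0 := by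
    have := hq0
    rw [sphereSq, div_eq_zero_iff, hu, sub_zero] at this
    exact this.resolve_right (by positivity)
  have a0 := sq_nonneg (v 0)
  have a1 := sq_nonneg (v 1)
  have a2 := sq_nonneg (v 2)
  ext i
  refine pow_eq_zero_iff two_ne_zero |>.1 ?_
  fin_cases i
  · change v 0 ^ 2 = 0; linarith
  · change v 1 ^ 2 = 0; linarith
  · change v 2 ^ 2 = 0; linarith
  · change v 3 ^ 2 = 0; rw [hτ]; norm_num

/-- The spheres `r = const` are light-concave far away. -/
theorem hessian_sphere_pos {m a k : ℝ} (hm : 0 < m) (ha : a ^ 2 < m ^ 2) {p v : Fin 4 → ℝ}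
    (hp : space p ∈ kerrRegion m a) (hR : 10 * m < radius (space p))
    (hv : fderiv ℝ (potential 0 0 k) (space p) (space v) = 0)
    (hl : IsLightlike (kerrMetric m a) p v) :
    0 < hessian (kerrMetric m a) (fun q => potential 0 0 k (space q)) p v v := by
  obtain ⟨hr, hΔ, hρ⟩ := pos_of_mem_kerrRegion hm ha hp
  have hρ0 := kerrRhoSq_pos a hr
  have hu : formDr (space p) ⬝ᵥ v = 0 := by
    have h := hv
    rw [fderiv_potential _ _ _ hr] at h
    have h' : 2 * (radius (space p) - 0) * (formDr (space p) ⬝ᵥ v) = 0 := by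
      rw [formDr_dotProduct]
      change 2 * (radius (space p) - 0) *
        ((space p 0 * space v 0 + space p 1 * space v 1 + space p 2 * space v 2) / _) = 0
      linarith
    exact (mul_eq_zero.1 h').resolve_left (by rw [sub_zero]; positivity)
  have h0 := hl.kerrForm_eq_zero hr
  have hs := formSinSqDphi_dotProduct_sq_le hr v
  have hN := sphereSq_add_sq_pos hm ha hp hl
  -- Here `dr = 0`. Were the angular part zero as well, the vector would be a multiple of `∂_t`,
  -- which is timelike outside the ergosurface.
  have hq : 0 < sphereSq (space p) v := by
    refine (sphereSq_nonneg hr v).lt_of_ne fun h => ?_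
    rw [← h] at hs h0 hN
    have hs0 : formSinSqDphi (space p) ⬝ᵥ v = 0 :=
      pow_eq_zero_iff two_ne_zero |>.1 (le_antisymm hs (sq_nonneg _))
    have h1 : v 3 ^ 2 * (1 - 2 * m * radius (space p) / kerrRhoSq a (space p)) = 0 := by
      rw [hu, hs0, kerrForm] at h0
      rw [kerrRhoSq]
      linarith
    have h2 : 0 < 1 - 2 * m * radius (space p) / kerrRhoSq a (space p) := by
      rw [sub_pos, div_lt_one hρ0]; exact hρ
    have : 0 < v 3 ^ 2 * (1 - 2 * m * radius (space p) / kerrRhoSq a (space p)) :=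
      mul_pos (by linarith) h2
    linarith
  rw [hu] at h0
  have hL := lieForm_pos_of_large hm ha hR hs hq h0
  have hH := kerrRhoSq_mul_hessian hm 0 0 k hr hΔ hρ hv
  rw [hu] at hH
  rw [← hH] at hL
  exact (mul_pos_iff_of_pos_left hρ0).1 hL

/-- For small `a`, the hypersurfaces `ρ² - 2 m r = ε` are light-convex. -/
theorem exists_hessian_inner_neg {m ε : ℝ} (hm : 0 < m) (hε : 0 < ε) (hε3 : ε < 3 * m ^ 2) :
    ∃ a₀ : ℝ, 0 < a₀ ∧ ∀ a : ℝ, a ^ 2 < m ^ 2 → |a| < a₀ → ∀ p v : Fin 4 → ℝ,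
      space p ∈ kerrRegion m a → potential m (a ^ 2) ε (space p) = 0 →
      fderiv ℝ (potential m (a ^ 2) ε) (space p) (space v) = 0 →
      IsLightlike (kerrMetric m a) p v →
      hessian (kerrMetric m a) (fun q => potential m (a ^ 2) ε (space q)) p v v < 0 := by
  obtain ⟨a₀, ha₀, H⟩ := exists_forall_lieForm_neg hm hε hε3
  refine ⟨a₀, ha₀, fun a ha haa p v hp hψ hv hl => ?_⟩
  obtain ⟨hr, hΔ, hρ⟩ := pos_of_mem_kerrRegion hm ha hp
  have ht : (radius (space p) - m) * (formDr (space p) ⬝ᵥ v)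
      + a ^ 2 * cosTheta (space p) * dCosTheta (space p) v = 0 := by
    have h := hv
    rw [fderiv_potential _ _ _ hr] at h
    rw [dCosTheta, formDr_dotProduct]
    change (radius (space p) - m) *
        ((space p 0 * space v 0 + space p 1 * space v 1 + space p 2 * space v 2) / _) + a ^ 2 * _ *
        ((space v 2 - _ * ((space p 0 * space v 0 + space p 1 * space v 1 + space p 2 * space v 2)
          / _)) / _) = 0
    linarith
  have hψ' : radius (space p) ^ 2 - 2 * m * radius (space p)
      + a ^ 2 * cosTheta (space p) ^ 2 = ε := by
    rw [potential] at hψ; linarith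
  have hL := H a _ _ _ _ _ _ _ haa ((mem_kerrRegion_iff ha).1 hp).1 hψ'
    (cosTheta_sq_le_one _) (dCosTheta_sq_le hr v) (formSinSqDphi_dotProduct_sq_le hr v)
    (sphereSq_add_sq_pos hm ha hp hl) ht (hl.kerrForm_eq_zero hr)
  rw [← kerrRhoSq_mul_hessian hm m (a ^ 2) ε hr hΔ hρ hv] at hL
  exact (pos_iff_neg_of_mul_neg hL).1 (kerrRhoSq_pos a hr)

theorem fderiv_mul_of_eq_zero {n : ℕ} {f h : (Fin n → ℝ) → ℝ} {x : Fin n → ℝ}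
    (hf : DifferentiableAt ℝ f x) (hh : DifferentiableAt ℝ h x) (h0 : f x = 0) (w : Fin n → ℝ) :
    fderiv ℝ (fun y => f y * h y) x w = h x * fderiv ℝ f x w := by
  rw [fderiv_fun_mul hf hh]
  simp [h0]

/-- The Hessian of `f h` on vectors tangent to the zero set of `f`, for functions of space. -/
theorem hessian_mul_comp_space (g : (Fin 4 → ℝ) → Matrix (Fin 4) (Fin 4) ℝ)
    {f h : (Fin 3 → ℝ) → ℝ} {p v : Fin 4 → ℝ} (hf : ContDiffAt ℝ 2 f (space p))
    (hh : ContDiffAt ℝ 2 h (space p)) (h0 : f (space p) = 0)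
    (hv : fderiv ℝ f (space p) (space v) = 0) :
    hessian g (fun q => f (space q) * h (space q)) p v v
      = h (space p) * hessian g (fun q => f (space q)) p v v := by
  have hsp : ContDiffAt ℝ 2 space p := contDiff_space.contDiffAt
  refine hessian_mul_of_eq_zero g (f := fun q => f (space q)) (h := fun q => h (space q))
    (ContDiffAt.comp (f := space) p hf hsp) (ContDiffAt.comp (f := space) p hh hsp) h0 ?_
  rw [← fderiv_apply_eq_sum_pderiv, fderiv_comp_space (hf.differentiableAt (by norm_num)), hv]

/-- The radial direction annihilates `d(cos θ)`. For `r > μ` the value is positive, which shows that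
the differential of the defining function does not vanish. -/
theorem fderiv_potential_self (μ b k : ℝ) {x : Fin 3 → ℝ} (hx : 0 < radius x) :
    fderiv ℝ (potential μ b k) x x = 2 * (radius x - μ) * radius x := by
  have h : x 0 * x 0 + x 1 * x 1 + x 2 * x 2 = radius x ^ 2 := by rw [radius_sq]; ring
  rw [fderiv_potential _ _ _ hx, h, ← cosTheta_mul_radius hx]
  field_simp
  ring

/-- For finite `r₀` the function is `-ηψ` with `η = r² - r₀²`, chosen over `r - r₀` so that `η` is
again a potential. On `ψ = 0` the cofactor `-η` is positive and preserves the inner sign; on `η = 0`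
the cofactor `-ψ` is negative and reverses the positive Hessian of `η`. -/
theorem hasStronglyLightConvexBoundary_of_factor {m a ε : ℝ} {r₀ : EReal} (hm : 0 < m)
    (ha : a ^ 2 < m ^ 2) (hε : 0 < ε) (hε3 : ε < 3 * m ^ 2) (hr₀ : ((10 * m : ℝ) : EReal) < r₀)
    (hinner : ∀ p v : Fin 4 → ℝ,
      space p ∈ kerrRegion m a → potential m (a ^ 2) ε (space p) = 0 →
      fderiv ℝ (potential m (a ^ 2) ε) (space p) (space v) = 0 →
      IsLightlike (kerrMetric m a) p v →
      hessian (kerrMetric m a) (fun q => potential m (a ^ 2) ε (space q)) p v v < 0) :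
    HasStronglyLightConvexBoundary (kerrRegion m a) (kerrMetric m a) (kerrShell m a ε r₀) := by
  have hr₀' : ((3 * m : ℝ) : EReal) < r₀ := (EReal.coe_lt_coe_iff.2 (by linarith)).trans hr₀
  have hfr := fun x => mem_frontier_kerrShell_iff (x := x) hm ha hε hε3 hr₀'
  have hreg : frontier (kerrShell m a ε r₀) ⊆ kerrRegion m a :=
    frontier_subset_closure.trans (closure_kerrShell_subset_kerrRegion r₀ hm ha hε)
  have hpos : ∀ x ∈ kerrRegion m a, m < radius x ∧ 0 < radius x := fun x hx =>
    ⟨((mem_kerrRegion_iff ha).1 hx).1, (pos_of_mem_kerrRegion hm ha hx).1⟩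
  have hψne : ∀ x ∈ kerrRegion m a, 0 < fderiv ℝ (potential m (a ^ 2) ε) x x := fun x hx => by
    rw [fderiv_potential_self _ _ _ (hpos x hx).2]
    have := (hpos x hx).1
    exact mul_pos (by linarith) (hpos x hx).2
  have hcd : ∀ (μ b k : ℝ) x, x ∈ kerrRegion m a → ∀ l : WithTop ℕ∞,
      ContDiffAt ℝ l (potential μ b k) x := fun μ b k x hx l =>
    contDiffAt_potential μ b k (hpos x hx).2
  induction r₀ with
  | bot => simp at hr₀
  | top =>
    refine ⟨potential m (a ^ 2) ε, ⟨isOpen_kerrShell _ hm ha hε.le,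
      isConnected_kerrShell hm ha hε hε3 hr₀', closure_kerrShell_subset_kerrRegion _ hm ha hε,
      fun x hx => (hcd _ _ _ x hx _).contDiffWithinAt, fun x hx => ?_,
      fun x hx => ((mem_kerrShell_iff ha hε.le).1 hx).2.1, fun x hx h => ?_⟩, ?_⟩
    · rw [hfr]
      simp [(hpos x hx).1]
    · have := hψne x (hreg hx)
      rw [h] at this
      exact lt_irrefl _ this
    · intro p hp v hv hl
      have h0 : potential m (a ^ 2) ε (space p) = 0 := by simpa using ((hfr _).1 hp).2
      exact hinner p v (hreg hp) h0 hv hl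
  | coe ρ =>
    have hρ : 10 * m < ρ := EReal.coe_lt_coe_iff.1 hr₀
    set ψ := potential m (a ^ 2) ε with hψ
    set η := potential 0 0 (ρ ^ 2) with hη
    have hηe : ∀ x, η x = radius x ^ 2 - ρ ^ 2 := fun x => by rw [hη, potential]; ring
    have hφ1 : (fun x => η x * -ψ x) = fun x => ψ x * -η x := by ext x; ring
    have hη0 : ∀ x, η x = 0 ↔ radius x = ρ := fun x => by
      rw [hηe, sub_eq_zero]
      exact sq_eq_sq₀ (radius_nonneg x) (by linarith)
    have hψneg : ∀ x, ψ x = 0 → η x < 0 := by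
      intro x hx
      have hac : 0 ≤ a ^ 2 * cosTheta x ^ 2 := by positivity
      have h3 : radius x < 3 * m := by
        rw [hψ, potential] at hx; nlinarith
      rw [hηe]
      nlinarith [radius_nonneg x]
    have hηpos : ∀ x, η x = 0 → 0 < ψ x := by
      intro x hx
      have hac : 0 ≤ a ^ 2 * cosTheta x ^ 2 := by positivity
      rw [hψ, potential, (hη0 x).1 hx]
      nlinarith
    have hcases : ∀ x ∈ frontier (kerrShell m a ε (ρ : EReal)), ψ x = 0 ∨ η x = 0 := by
      intro x hx
      rcases ((hfr x).1 hx).2 with h | h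
      · exact Or.inl h
      · exact Or.inr ((hη0 x).2 (EReal.coe_eq_coe_iff.1 h))
    have hψd : ∀ x ∈ kerrRegion m a, ∀ l : WithTop ℕ∞, ContDiffAt ℝ l ψ x := hcd _ _ _
    have hηd : ∀ x ∈ kerrRegion m a, ∀ l : WithTop ℕ∞, ContDiffAt ℝ l η x := hcd _ _ _
    have hd1 : ∀ x ∈ kerrRegion m a, ψ x = 0 → ∀ w,
        fderiv ℝ (fun x => η x * -ψ x) x w = -η x * fderiv ℝ ψ x w := by
      intro x hx h w
      rw [hφ1]
      exact fderiv_mul_of_eq_zero ((hψd x hx 1).differentiableAt (by norm_num))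
        ((hηd x hx 1).differentiableAt (by norm_num)).fun_neg h w
    have hd2 : ∀ x ∈ kerrRegion m a, η x = 0 → ∀ w,
        fderiv ℝ (fun x => η x * -ψ x) x w = -ψ x * fderiv ℝ η x w := by
      intro x hx h w
      exact fderiv_mul_of_eq_zero ((hηd x hx 1).differentiableAt (by norm_num))
        ((hψd x hx 1).differentiableAt (by norm_num)).fun_neg h w
    refine ⟨fun x => η x * -ψ x, ⟨isOpen_kerrShell _ hm ha hε.le,
      isConnected_kerrShell hm ha hε hε3 hr₀', closure_kerrShell_subset_kerrRegion _ hm ha hε,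
      fun x hx => ((hηd x hx _).mul (hψd x hx _).neg).contDiffWithinAt, fun x hx => ?_,
      fun x hx => ?_, fun x hx h => ?_⟩, ?_⟩
    · rw [hfr, mul_eq_zero, neg_eq_zero, hη0, EReal.coe_eq_coe_iff]
      have := (hpos x hx).1
      tauto
    · obtain ⟨-, h2, h3⟩ := (mem_kerrShell_iff ha hε.le).1 hx
      refine mul_pos_of_neg_of_neg ?_ (neg_neg_of_pos h2)
      rw [hηe]
      have := EReal.coe_lt_coe_iff.1 h3
      nlinarith [radius_nonneg x]
    · have hxr := hreg hx
      rcases hcases x hx with h0 | h0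
      · have := hd1 x hxr h0 x
        rw [h] at this
        have h2 := mul_pos (neg_pos.2 (hψneg x h0)) (hψne x hxr)
        rw [← this] at h2
        exact lt_irrefl _ h2
      · have := hd2 x hxr h0 x
        rw [h, hη, fderiv_potential_self _ _ _ (hpos x hxr).2] at this
        have h2 := mul_pos (hηpos x h0) (pow_pos (hpos x hxr).2 2)
        have h3 : (0 : ℝ) = -ψ x * (2 * (radius x - 0) * radius x) := this
        nlinarith
    · intro p hp v hv hl
      have hxr := hreg hp
      rcases hcases _ hp with h0 | h0
      · rw [hd1 _ hxr h0] at hv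
        have hv' := (mul_eq_zero.1 hv).resolve_left (neg_pos.2 (hψneg _ h0)).ne'
        have e : (fun q => η (space q) * -ψ (space q)) = fun q => ψ (space q) * -η (space q) := by
          ext q; ring
        rw [e, hessian_mul_comp_space _ (hψd _ hxr 2) (h := fun x => -η x) (hηd _ hxr 2).neg h0 hv']
        exact mul_neg_of_pos_of_neg (neg_pos.2 (hψneg _ h0)) (hinner p v hxr h0 hv' hl)
      · rw [hd2 _ hxr h0] at hv
        have hv' := (mul_eq_zero.1 hv).resolve_left (neg_neg_of_pos (hηpos _ h0)).ne
        rw [hessian_mul_comp_space _ (hηd _ hxr 2) (h := fun x => -ψ x) (hψd _ hxr 2).neg h0 hv']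
        refine mul_neg_of_neg_of_pos (neg_neg_of_pos (hηpos _ h0)) ?_
        exact hessian_sphere_pos hm ha hxr (by rw [(hη0 _).1 h0]; exact hρ) hv' hl

end KerrShell

end

theorem corollary4p7 (m : ℝ) (hm : 0 < m) :
    ∃ R : ℝ, 0 < R ∧ ∀ ε : ℝ, 0 < ε → ε < 3 * m ^ 2 →
      ∃ a₀ : ℝ, 0 < a₀ ∧ ∀ a : ℝ, a ^ 2 < m ^ 2 → |a| < a₀ →
        ∀ r₀ : EReal, (R : EReal) < r₀ →
          KerrShell.HasStronglyLightConvexBoundary (KerrShell.kerrRegion m a)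
            (KerrShell.kerrMetric m a) (KerrShell.kerrShell m a ε r₀) := by
  -- The radius `10m` is what the outer estimate needs, and it exceeds the bound `3m` on the inner
  -- boundary.
  refine ⟨10 * m, by positivity, fun ε hε hε3 => ?_⟩
  obtain ⟨a₀, ha₀, H⟩ := KerrShell.exists_hessian_inner_neg hm hε hε3
  exact ⟨a₀, ha₀, fun a ha haa r₀ hr₀ =>
    KerrShell.hasStronglyLightConvexBoundary_of_factor hm ha hε hε3 hr₀ (H a ha haa)⟩
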